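/- **Setting.** A qubit channel is a completely positive trace-preserving linear map $A$ on $\mathcal L(\mathbb C^2)$; its Choi operator is $J^A=\sum_{i,j}|i\rangle\langle j|\otimes A[|i\rangle\langle j|]$. For qubit channels $A,B$ with Kraus operators $\{A_i\}$, $\{B_j\}$, the quantum switch is the channel on a control qubit $c$ and a target qubit $t$ given by $$\mathcal S(A,B)[\rho]=\sum_{i,j}S_{ij}\,\rho\,S_{ij}^\dagger,\qquad S_{ij}=|0\rangle\langle 0|\otimes B_jA_i+|1\rangle\langle 1|\otimes A_iB_j .$$ A $k$-slot quantum comb is a positive semidefinite operator $C$ on $\mathcal H^{P}\otimes\mathcal H^{I_1}\otimes\mathcal H^{O_1}\otimes\dots\otimes\mathcal H^{I_k}\otimes\mathcal H^{O_k}\otimes\mathcal H^{F}$, where $P=c_It_I$ and $F=t_Oc_O$ are pairs of qubits and all $I_j,O_j$ are qubits, with $\operatorname{Tr}C=4\cdot 2^k$ and $\mathbb P_k(C)=C$. Here, writing ${}_XC=\operatorname{Tr}_X(C)\otimes\mathbb 1^X/d_X$, $$\mathbb P_k(C)=C-{}_FC+{}_{O_kF}C-{}_{I_kO_kF}C+{}_{O_{k-1}I_kO_kF}C-\dots-{}_{I_1O_1\cdots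 I_kO_kF}C+{}_{PI_1O_1\cdots I_kO_kF}C .$$ The success part of a probabilistic comb is an operator $C_s\ge 0$ with $C-C_s\ge 0$ for some $k$-slot comb $C$. For such operators, $\mathcal C_s(A^{\otimes k})$ denotes the map from $\mathcal L(\mathcal H^{P})$ to $\mathcal L(\mathcal H^{F})$ whose Choi operator is the link product $C_s*(J^A)^{\otimes k}=\operatorname{Tr}_{I_1O_1\cdots I_kO_k}\big[C_s\,\big(\mathbb 1^{PF}\otimes((J^A)^{\otimes k})^{T}\big)\big]$, with one copy of $J^A$ in each slot. A probabilistic restricted simulation, with $k$ calls and success probability $p$, of the switch acting on two identical qubit channels is the success part $C_s$ of a $k$-slot probabilistic comb with $$\operatorname{Tr}_{t_O}\!\big(\mathcal C_s(A^{\otimes k})[\,|+\rangle\langle+|\otimes|0\rangle\langle 0|\,]\big)=p\,\operatorname{Tr}_{t_O}\!\big(\mathcal S(A,A)[\,|+\rangle\langle+|\otimes|0\rangle\langle 0|\,]\big)\quad\text{for all qubit channels }A,$$ where $p$ does not depend on $A$. It is deterministic if $C_s$ is itself a $k$-slot comb and $p=1$. **Claim.** 1. ($k=2$, order AA) Every probabilistic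 restricted simulation with $2$ calls has $p<\frac{4001}{10000}$. 2. ($k=3$, order AAA) Every probabilistic restricted simulation with $3$ calls has $p<\frac{6534}{10000}$. 3. In particular, no deterministic restricted simulation exists with $2$ calls, and none exists with $3$ calls. -/

import Mathlib

open Matrix
open scoped Kronecker ComplexOrder

noncomputable section

namespace SwitchSim

/-- Operators on one qubit, in the computational basis. -/
abbrev Qubit : Type := Matrix (Fin 2) (Fin 2) ℂ

/-- Operators on a control qubit and a target qubit; the first index is the control. -/
abbrev CtrlTarget : Type := Matrix (Fin 2 × Fin 2) (Fin 2 × Fin 2) ℂ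

/-! ### Qubit channels -/

/-- A qubit channel: a completely positive trace-preserving linear map on the operators of a
qubit. -/
structure QubitChannel extends
    CompletelyPositiveMap (CStarMatrix (Fin 2) (Fin 2) ℂ) (CStarMatrix (Fin 2) (Fin 2) ℂ) where
  trace_preserving : ∀ M : CStarMatrix (Fin 2) (Fin 2) ℂ,
    (CStarMatrix.ofMatrix.symm (toFun M)).trace = (CStarMatrix.ofMatrix.symm M).trace

/-- The output `A[ρ]` of the channel `A` on the operator `ρ`. -/
def QubitChannel.app (A : QubitChannel) (ρ : Qubit) : Qubit :=
  CStarMatrix.ofMatrix.symm (A.toFun (CStarMatrix.ofMatrix ρ))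

/-- The Choi operator `∑ i j, |i⟩⟨j| ⊗ A[|i⟩⟨j|]`; an index is a pair (input, output). -/
def QubitChannel.choi (A : QubitChannel) : Matrix (Fin 2 × Fin 2) (Fin 2 × Fin 2) ℂ :=
  Matrix.of fun x y => A.app (Matrix.single x.1 y.1 1) x.2 y.2

/-- The finite family `K` is a Kraus representation of the channel `A`. -/
def IsKrausRep {n : ℕ} (K : Fin n → Qubit) (A : QubitChannel) : Prop :=
  ∀ ρ : Qubit, A.app ρ = ∑ i, K i * ρ * (K i)ᴴ

/-! ### The quantum switch -/

/-- The Kraus operator `|0⟩⟨0| ⊗ B A + |1⟩⟨1| ⊗ A B` of the switched channel that belongs to Kraus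
operators `A` and `B` of the two channels. -/
def switchKraus (A B : Qubit) : CtrlTarget :=
  Matrix.single (0 : Fin 2) (0 : Fin 2) (1 : ℂ) ⊗ₖ (B * A) +
    Matrix.single (1 : Fin 2) (1 : Fin 2) (1 : ℂ) ⊗ₖ (A * B)

/-- The quantum switch of two channels with Kraus operators `K i` and `L j`, applied to the joint
operator `ρ` of control and target. -/
def switch {m n : ℕ} (K : Fin m → Qubit) (L : Fin n → Qubit) (ρ : CtrlTarget) : CtrlTarget :=
  ∑ i, ∑ j, switchKraus (K i) (L j) * ρ * (switchKraus (K i) (L j))ᴴ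

/-- The fixed input `|+⟩⟨+| ⊗ |0⟩⟨0|` of control and target. -/
def inputState : CtrlTarget :=
  !![1 / 2, 1 / 2; 1 / 2, 1 / 2] ⊗ₖ Matrix.single (0 : Fin 2) (0 : Fin 2) (1 : ℂ)

/-- The partial trace over the target. -/
def traceTarget (M : CtrlTarget) : Qubit :=
  Matrix.of fun c c' => ∑ t, M (c, t) (c', t)

/-! ### Quantum combs -/

/-- The qubit systems on which the Choi operator of a `k`-slot comb acts: input control and target
(global past), input and output system of the channel in slot `j`, output control and target
(global future). -/
inductive Wire (k : ℕ) where
  | ctrlIn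
  | targIn
  | slotIn (j : Fin k)
  | slotOut (j : Fin k)
  | ctrlOut
  | targOut
  deriving DecidableEq, Fintype

/-- Operators on all systems of a `k`-slot comb; an index is a computational basis vector. -/
abbrev CombOp (k : ℕ) : Type := Matrix (Wire k → Fin 2) (Wire k → Fin 2) ℂ

/-- The causal order of the systems: the global past comes first, then the input and the output of
slot `0`, of slot `1`, and so on, and the global future comes last. -/
def Wire.time {k : ℕ} : Wire k → ℕ
  | .ctrlIn => 0
  | .targIn => 0
  | .slotIn j => 2 * (j : ℕ) + 1
  | .slotOut j => 2 * (j : ℕ) + 2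
  | .ctrlOut => 2 * k + 1
  | .targOut => 2 * k + 1

/-- The systems at time `m` or later. -/
def wiresFrom (k m : ℕ) : Finset (Wire k) :=
  Finset.univ.filter fun w => m ≤ w.time

/-- Trace-and-replace: trace out the systems in `X` and put the maximally mixed operator
`𝟙 / 2 ^ |X|` there. -/
def traceReplace {k : ℕ} (X : Finset (Wire k)) (C : CombOp k) : CombOp k :=
  Matrix.of fun a b =>
    if ∀ w ∈ X, a w = b w then
      (1 / 2 ^ X.card : ℂ) *
        ∑ x : X → Fin 2, C (Function.updateFinset a X x) (Function.updateFinset b X x)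
    else 0

/-- The projector onto the linear span of `k`-slot combs. With `F` the global future and `P` the
global past, the terms at `m = 2k + 1, 2k, 2k - 1, 2k - 2, …, 1, 0` are
`- _F C`, `+ _{O_k F} C`, `- _{I_k O_k F} C`, `+ _{O_{k-1} I_k O_k F} C`, …,
`- _{I_1 O_1 … F} C`, `+ _{P I_1 O_1 … F} C`. -/
def combProj (k : ℕ) (C : CombOp k) : CombOp k :=
  C + ∑ m ∈ Finset.range (2 * k + 2), (-1 : ℂ) ^ m • traceReplace (wiresFrom k m) C

/-- `C` is the Choi operator of a (deterministic) `k`-slot quantum comb with a control qubit and a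
target qubit both in its global past and in its global future. -/
structure IsComb {k : ℕ} (C : CombOp k) : Prop where
  posSemidef : C.PosSemidef
  trace_eq : C.trace = 2 * 2 * 2 ^ k
  proj_eq : combProj k C = C

/-- `Cs` is the success part of a probabilistic comb `Cs + Cf`: both parts are positive semidefinite
and their sum is a comb. -/
def IsProbComb {k : ℕ} (Cs : CombOp k) : Prop :=
  ∃ C : CombOp k, IsComb C ∧ Cs.PosSemidef ∧ (C - Cs).PosSemidef

/-- The basis vector of all systems of a comb with `p` in the global past, `f` in the global future
(control first) and `a j` at the input and output of slot `j`. -/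
def combIndex {k : ℕ} (p : Fin 2 × Fin 2) (a : Fin k → Fin 2 × Fin 2) (f : Fin 2 × Fin 2) :
    Wire k → Fin 2
  | .ctrlIn => p.1
  | .targIn => p.2
  | .slotIn j => (a j).1
  | .slotOut j => (a j).2
  | .ctrlOut => f.1
  | .targOut => f.2

/-- The Choi operator (global past first) of the map that results from inserting the map with Choi
operator `J j` into slot `j`: the link product `C * (J 0 ⊗ J 1 ⊗ …)`, that is, the partial trace of
`C (J 0 ⊗ J 1 ⊗ …)ᵀ` over the systems of the slots. -/
def combInsert {k : ℕ} (C : CombOp k) (J : Fin k → Matrix (Fin 2 × Fin 2) (Fin 2 × Fin 2) ℂ) :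
    Matrix ((Fin 2 × Fin 2) × (Fin 2 × Fin 2)) ((Fin 2 × Fin 2) × (Fin 2 × Fin 2)) ℂ :=
  Matrix.of fun x y =>
    ∑ a : Fin k → Fin 2 × Fin 2, ∑ b : Fin k → Fin 2 × Fin 2,
      C (combIndex x.1 a x.2) (combIndex y.1 b y.2) * ∏ j, J j (a j) (b j)

/-- The map on operators of control and target with Choi operator `M`. -/
def mapOfChoi
    (M : Matrix ((Fin 2 × Fin 2) × (Fin 2 × Fin 2)) ((Fin 2 × Fin 2) × (Fin 2 × Fin 2)) ℂ)
    (ρ : CtrlTarget) : CtrlTarget :=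
  Matrix.of fun f g => ∑ i, ∑ j, ρ i j * M (i, f) (j, g)

/-- `𝒞(A, …, A)[ρ]`: the comb with Choi operator `C` acts on `k` calls of the channel `A`, and the
resulting map is applied to `ρ`. -/
def combApply {k : ℕ} (C : CombOp k) (A : QubitChannel) (ρ : CtrlTarget) : CtrlTarget :=
  mapOfChoi (combInsert C fun _ => A.choi) ρ

/-! ### Restricted simulation of the switch on two copies of one channel -/

/-- On the fixed input and with the output target discarded, `C` acting on `k` calls of `A` gives
`p` times the output of the switch of `A` with `A`, for every qubit channel `A`. The switch does not
depend on the Kraus representations `K` and `L` of the two copies of `A`. -/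
def ReproducesSwitch {k : ℕ} (C : CombOp k) (p : ℝ) : Prop :=
  ∀ (A : QubitChannel) (m n : ℕ) (K : Fin m → Qubit) (L : Fin n → Qubit),
    IsKrausRep K A → IsKrausRep L A →
      traceTarget (combApply C A inputState) = (p : ℂ) • traceTarget (switch K L inputState)

/-- A probabilistic restricted simulation with `k` calls and success probability `p` exists. -/
def RestrictedSimulable (k : ℕ) (p : ℝ) : Prop :=
  ∃ Cs : CombOp k, IsProbComb Cs ∧ ReproducesSwitch Cs p

/-- A deterministic restricted simulation with `k` calls exists. -/
def DeterministicallySimulable (k : ℕ) : Prop :=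
  ∃ C : CombOp k, IsComb C ∧ ReproducesSwitch C 1

end SwitchSim

end

/-!
The success probability of a restricted simulation is bounded by weak duality of semidefinite
programming, with explicit rational dual solutions.

On the input `|+⟩⟨+| ⊗ |0⟩⟨0|`, the control output of the switch of `A` with itself has diagonal
`1 / 2` and off-diagonal entry half of `switchForm A.choi`, a quadratic form in the Choi operator of
`A` (`traceTarget_switch`). Projecting the control of a simulation `Cs` on `|±⟩` gives two positive
semidefinite operators on the slots, `tester 1 Cs` and `tester (-1) Cs`. They pair with `J ⊗ ⋯ ⊗ J`
to `p (1 ± switchForm J) / 2` for every Choi operator `J` of a channel. This identity is polynomial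
in `J`. Hence it extends from channels to their complex span (`evalAt_eq_zero_of_outTrace`) and by
polarisation to the symmetric operators `X` in the tensor power of that span:
`pairing (tester s Cs) X = p * pairing (switchTarget n s) X`
(`ReproducesSwitch.sum_tester_mul`).

A comb, on the other hand, has a fixed pairing with every operator that satisfies the dual causality
constraints: if tracing out the last output of `Ω (n + 1)` leaves `𝟙 ⊗ Ω n` for all `n`, then the
two testers of a comb pair with `Ω k` to the number `Ω 0` in total (`IsComb.pairing_liftOp`,
`pairing_tester_add`). If moreover `Ω k ≥ 0` and `Ω k ≥ X₊`, `Ω k ≥ X₋`, then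
`p (pairing (switchTarget n 1) X₊ + pairing (switchTarget n (-1)) X₋) ≤ Ω 0`
(`RestrictedSimulable.mul_le`).

It remains to exhibit `Ω`, `X₊` and `X₋`. They are integer matrices obtained by rounding a
numerical optimum of the semidefinite program. The linear constraints and the value of the bound
are integer identities. For the positivity of `Y = Ω`, `Ω - X₊`, `Ω - X₋`, a rounded Cholesky
factor `L` is given such that `s Y - L Lᵀ` is diagonally dominant (`HasFactor.posSemidef`). The
bounds that result are about `0.40006` for two calls and `0.65331` for three. A deterministic
simulation would have `p = 1`.
-/

namespace SwitchSim

/-! ### Channels, Choi operators and the control output of the switch -/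

/-- The channel with Kraus operators `K`. -/
noncomputable def krausChannel {n : ℕ} (K : Fin n → Qubit) (hK : ∑ r, (K r)ᴴ * K r = 1) :
    QubitChannel where
  toFun ρ := CStarMatrix.ofMatrix (∑ r, K r * CStarMatrix.ofMatrix.symm ρ * (K r)ᴴ)
  map_add' ρ σ := by
    have : CStarMatrix.ofMatrix.symm (ρ + σ) =
        CStarMatrix.ofMatrix.symm ρ + CStarMatrix.ofMatrix.symm σ := rfl
    simp only [this, mul_add, add_mul, Finset.sum_add_distrib]
    rfl
  map_smul' c ρ := by
    have : CStarMatrix.ofMatrix.symm (c • ρ) = c • CStarMatrix.ofMatrix.symm ρ := rfl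
    simp only [this, Matrix.mul_smul, Matrix.smul_mul, ← Finset.smul_sum]
    rfl
  map_cstarMatrix_nonneg' k M hM := by
    let D : Fin n → CStarMatrix (Fin k) (Fin k) (CStarMatrix (Fin 2) (Fin 2) ℂ) := fun r =>
      CStarMatrix.ofMatrix (Matrix.diagonal fun _ => CStarMatrix.ofMatrix (K r))
    have key : (M.map fun ρ : CStarMatrix (Fin 2) (Fin 2) ℂ =>
        CStarMatrix.ofMatrix (∑ r, K r * CStarMatrix.ofMatrix.symm ρ * (K r)ᴴ)) =
        ∑ r, D r * M * star (D r) := by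
      have hD : ∀ r, D r * M * star (D r) = CStarMatrix.ofMatrix (Matrix.of fun i j =>
          CStarMatrix.ofMatrix (K r * CStarMatrix.ofMatrix.symm (M i j) * (K r)ᴴ)) := by
        intro r
        have hs : star (D r) = CStarMatrix.ofMatrix
            (Matrix.diagonal fun _ => CStarMatrix.ofMatrix ((K r)ᴴ)) := by
          have := Matrix.diagonal_conjTranspose
            (fun _ : Fin k => (CStarMatrix.ofMatrix (K r) : CStarMatrix (Fin 2) (Fin 2) ℂ))
          exact this
        rw [hs]
        ext1 i j
        have h1 : (D r * M) = CStarMatrix.ofMatrix (Matrix.diagonal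
            (fun _ => (CStarMatrix.ofMatrix (K r) : CStarMatrix (Fin 2) (Fin 2) ℂ)) *
            CStarMatrix.ofMatrix.symm M) := rfl
        have h2 : ∀ A B : Matrix (Fin k) (Fin k) (CStarMatrix (Fin 2) (Fin 2) ℂ),
          (CStarMatrix.ofMatrix A * CStarMatrix.ofMatrix B) i j = (A * B) i j := fun _ _ => rfl
        rw [h1, h2, Matrix.mul_diagonal, Matrix.diagonal_mul]
        rfl
      rw [Finset.sum_congr rfl fun r _ => hD r]
      ext1 i j
      have hsum : ∀ (s : Finset (Fin n))
          (f : Fin n → CStarMatrix (Fin k) (Fin k) (CStarMatrix (Fin 2) (Fin 2) ℂ)),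
          (∑ r ∈ s, f r) i j = ∑ r ∈ s, f r i j := by
        intro s f
        classical
        induction s using Finset.induction_on with
        | empty => rfl
        | insert a s ha ih => rw [Finset.sum_insert ha, Finset.sum_insert ha, ← ih]; rfl
      rw [hsum]
      exact map_sum (CStarMatrix.ofMatrixₗ (m := Fin 2) (n := Fin 2) (A := ℂ) (R := ℂ))
        (fun r => K r * CStarMatrix.ofMatrix.symm (M i j) * (K r)ᴴ) Finset.univ
    have : (M.map fun ρ : CStarMatrix (Fin 2) (Fin 2) ℂ =>
        CStarMatrix.ofMatrix (∑ r, K r * CStarMatrix.ofMatrix.symm ρ * (K r)ᴴ)) ≥ 0 := by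
      rw [key]
      exact Finset.sum_nonneg fun r _ => star_right_conjugate_nonneg hM _
    exact this
  trace_preserving M := by
    change (∑ r, K r * CStarMatrix.ofMatrix.symm M * (K r)ᴴ).trace = _
    rw [Matrix.trace_sum]
    simp only [Matrix.trace_mul_cycle (K _) _ ((K _)ᴴ)]
    rw [← Matrix.trace_sum, ← Finset.sum_mul, hK, one_mul]

theorem isKrausRep_krausChannel {n : ℕ} (K : Fin n → Qubit) (hK : ∑ r, (K r)ᴴ * K r = 1) :
    IsKrausRep K (krausChannel K hK) := fun _ => rfl

theorem IsKrausRep.choi_apply {n : ℕ} {K : Fin n → Qubit} {A : QubitChannel}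
    (hK : IsKrausRep K A) (x y : Fin 2 × Fin 2) :
    A.choi x y = ∑ r, K r x.2 x.1 * star (K r y.2 y.1) := by
  rw [QubitChannel.choi, of_apply, hK, Matrix.sum_apply]
  refine Finset.sum_congr rfl fun r _ => ?_
  simp only [Matrix.mul_apply, Matrix.single_apply, conjTranspose_apply, Fin.sum_univ_two]
  obtain ⟨x1, x2⟩ := x
  obtain ⟨y1, y2⟩ := y
  fin_cases x1 <;> fin_cases y1 <;> simp

/-- The partial trace of `x` over the output system is `t` times the identity of the input system.
For `t = 1` and positive semidefinite `x` these are the Choi operators of the channels. -/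
def OutTrace (t : ℂ) (x : Matrix (Fin 2 × Fin 2) (Fin 2 × Fin 2) ℂ) : Prop :=
  ∀ i i' : Fin 2, ∑ o, x (i, o) (i', o) = if i = i' then t else 0

/-- A positive semidefinite operator whose partial trace over the output is the identity is the
Choi operator of a channel, and that channel has Kraus operators. -/
theorem exists_channel_of_posSemidef {J : Matrix (Fin 2 × Fin 2) (Fin 2 × Fin 2) ℂ}
    (hJ : J.PosSemidef) (hJ' : OutTrace 1 J) :
    ∃ (A : QubitChannel) (n : ℕ) (K : Fin n → Qubit), IsKrausRep K A ∧ A.choi = J := by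
  obtain ⟨n, v, hv⟩ := Matrix.posSemidef_iff_eq_sum_vecMulVec.mp hJ
  have hJv : ∀ x y, J x y = ∑ r, v r x * star (v r y) := by
    intro x y
    rw [hv, Matrix.sum_apply]
    rfl
  let K : Fin n → Qubit := fun r => Matrix.of fun o i => v r (i, o)
  have hK : ∑ r, (K r)ᴴ * K r = 1 := by
    ext i i'
    have h := hJ' i' i
    simp only [hJv] at h
    rw [Finset.sum_comm] at h
    simp only [Matrix.sum_apply, Matrix.mul_apply, conjTranspose_apply, K, of_apply,
      Matrix.one_apply]
    refine Eq.trans ?_ (h.trans (by simp only [eq_comm]))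
    exact Finset.sum_congr rfl fun r _ => Finset.sum_congr rfl fun o _ => mul_comm _ _
  refine ⟨krausChannel K hK, _, K, isKrausRep_krausChannel K hK, ?_⟩
  ext x y
  rw [(isKrausRep_krausChannel K hK).choi_apply, hJv]
  simp [K]

theorem QubitChannel.outTrace_choi (A : QubitChannel) : OutTrace 1 A.choi := by
  intro i i'
  have h := A.trace_preserving (CStarMatrix.ofMatrix (Matrix.single i i' 1))
  have h' : ∑ o, A.choi (i, o) (i', o) = (Matrix.single i i' (1 : ℂ)).trace := h
  rw [h', Matrix.trace]
  fin_cases i <;> fin_cases i' <;> simp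

/-- The quadratic form in the Choi operator of `A` that gives `∑ i j, ⟨0|Aⱼ† Aᵢ† Aⱼ Aᵢ|0⟩` for
Kraus operators `Aᵢ` of `A`; it decides the control output of the switch. -/
def switchForm (x : Matrix (Fin 2 × Fin 2) (Fin 2 × Fin 2) ℂ) : ℂ :=
  ∑ t, ∑ s, ∑ u, x (0, s) (u, t) * x (s, t) (0, u)

theorem switchKraus_apply (A B : Qubit) (c t c' t' : Fin 2) :
    switchKraus A B (c, t) (c', t') =
      if c = c' then (if c = 0 then B * A else A * B) t t' else 0 := by
  fin_cases c <;> fin_cases c' <;> simp [switchKraus, Matrix.kroneckerMap_apply]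

theorem inputState_apply (c t c' t' : Fin 2) :
    inputState (c, t) (c', t') = if t = 0 ∧ t' = 0 then 1 / 2 else 0 := by
  fin_cases c <;> fin_cases c' <;> fin_cases t <;> fin_cases t' <;>
    simp [inputState, Matrix.kroneckerMap_apply]

theorem switchKraus_conj_inputState (A B : Qubit) (c d t : Fin 2) :
    (switchKraus A B * inputState * (switchKraus A B)ᴴ) (c, t) (d, t) =
      (if c = 0 then B * A else A * B) t 0 * star ((if d = 0 then B * A else A * B) t 0) / 2 := by
  simp only [Matrix.mul_apply, Fintype.sum_prod_type, conjTranspose_apply, switchKraus_apply,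
    inputState_apply, Fin.sum_univ_two]
  fin_cases c <;> fin_cases d <;> simp <;> ring

/-- The control output of the switch: the diagonal comes from trace preservation, the coherence is
the switch form. -/
theorem traceTarget_switch {m n : ℕ} {K : Fin m → Qubit} {L : Fin n → Qubit} {A : QubitChannel}
    (hK : IsKrausRep K A) (hL : IsKrausRep L A) (c d : Fin 2) :
    traceTarget (switch K L inputState) c d =
      if c = d then 1 / 2 else switchForm A.choi / 2 := by
  have hexp : traceTarget (switch K L inputState) c d = ∑ i, ∑ j, ∑ t,
      (if c = 0 then L j * K i else K i * L j) t 0 *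
        star ((if d = 0 then L j * K i else K i * L j) t 0) / 2 := by
    simp only [traceTarget, of_apply, switch, Matrix.sum_apply, switchKraus_conj_inputState]
    rw [Finset.sum_comm]
    exact Finset.sum_congr rfl fun i _ => Finset.sum_comm
  -- trace preservation, applied twice
  have hTP : ∑ t, ∑ s, ∑ u, A.choi (0, s) (0, u) * A.choi (s, t) (u, t) = 1 := by
    have h1 : ∀ s u : Fin 2, ∑ t, A.choi (s, t) (u, t) = if s = u then 1 else 0 :=
      A.outTrace_choi
    have h0 := A.outTrace_choi 0 0
    rw [Finset.sum_comm]
    simp_rw [Finset.sum_comm (s := Finset.univ) (t := Finset.univ)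
      (f := fun t u => A.choi (0, _) (0, u) * A.choi (_, t) (u, t)), ← Finset.mul_sum, h1]
    simpa using h0
  have hfin : ∀ z w : Fin 2, z ≠ 0 → w ≠ 0 → z = w := by decide
  -- The two copies of `A` may be written with either of the two Kraus families; the order is chosen
  -- such that the products `L j * K i` and `K i * L j` come out.
  have hKL : ∀ x y z w, A.choi x y * A.choi z w = ∑ i, ∑ j,
      K i x.2 x.1 * star (K i y.2 y.1) * (L j z.2 z.1 * star (L j w.2 w.1)) := fun x y z w => by
    rw [hK.choi_apply x, hL.choi_apply z, Finset.sum_mul_sum]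
  have hLK : ∀ x y z w, A.choi x y * A.choi z w = ∑ i, ∑ j,
      K i z.2 z.1 * star (K i w.2 w.1) * (L j x.2 x.1 * star (L j y.2 y.1)) := fun x y z w => by
    rw [mul_comm, hKL]
  rw [hexp]
  by_cases hc : c = 0 <;> by_cases hd : d = 0
  · rw [if_pos (hc.trans hd.symm), ← hTP]
    simp only [if_pos hc, if_pos hd, hKL]
    simp only [Fin.sum_univ_two, ← Finset.sum_add_distrib, Finset.sum_div, Matrix.mul_apply]
    refine Finset.sum_congr rfl fun i _ => Finset.sum_congr rfl fun j _ => ?_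
    simp only [star_add, star_mul']
    ring
  · rw [if_neg (show ¬c = d from fun h => hd (h ▸ hc))]
    simp only [if_pos hc, if_neg hd, switchForm, hKL]
    simp only [Fin.sum_univ_two, ← Finset.sum_add_distrib, Finset.sum_div, Matrix.mul_apply]
    refine Finset.sum_congr rfl fun i _ => Finset.sum_congr rfl fun j _ => ?_
    simp only [star_add, star_mul']
    ring
  · rw [if_neg (show ¬c = d from fun h => hc (h ▸ hd))]
    simp only [if_neg hc, if_pos hd, switchForm, hLK]
    simp only [Fin.sum_univ_two, ← Finset.sum_add_distrib, Finset.sum_div, Matrix.mul_apply]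
    refine Finset.sum_congr rfl fun i _ => Finset.sum_congr rfl fun j _ => ?_
    simp only [star_add, star_mul']
    ring
  · rw [if_pos (hfin c d hc hd), ← hTP]
    simp only [if_neg hc, if_neg hd, hLK]
    simp only [Fin.sum_univ_two, ← Finset.sum_add_distrib, Finset.sum_div, Matrix.mul_apply]
    refine Finset.sum_congr rfl fun i _ => Finset.sum_congr rfl fun j _ => ?_
    simp only [star_add, star_mul']
    ring

/-! ### The tester of a comb -/

/-- Basis vectors of the slots of a comb: an input and an output value for each slot. -/
abbrev Slots (k : ℕ) : Type := Fin k → Fin 2 × Fin 2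

/-- Operators on the input and output system of one slot. -/
abbrev SlotOp : Type := Matrix (Fin 2 × Fin 2) (Fin 2 × Fin 2) ℂ

/-- The operator on the slots that is left of `C` when the input `|+⟩⟨+| ⊗ |0⟩⟨0|` is inserted, the
output target is discarded, and the output control is projected on `|+⟩` (for `s = 1`) or on `|-⟩`
(for `s = -1`). -/
noncomputable def tester {k : ℕ} (s : ℝ) (C : CombOp k) : Matrix (Slots k) (Slots k) ℂ :=
  Matrix.of fun a b => ∑ t : Fin 2, ∑ e : Fin 2, ∑ c : Fin 2, ∑ f : Fin 2, ∑ d : Fin 2,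
    1 / 4 * (s : ℂ) ^ (c : ℕ) * (s : ℂ) ^ (d : ℕ) *
      C (combIndex (e, 0) a (c, t)) (combIndex (f, 0) b (d, t))

theorem posSemidef_tester {k : ℕ} (s : ℝ) {C : CombOp k} (hC : C.PosSemidef) :
    (tester s C).PosSemidef := by
  -- the vector `½ ∑ e c, s ^ c |e, 0, c, t⟩` on the outer systems
  let U : Matrix (Fin 2 × Fin 2 × Slots k) (Slots k) ℂ :=
    Matrix.of fun x a => if x.2.2 = a then 1 / 2 * (s : ℂ) ^ (x.2.1 : ℕ) else 0
  let v : Fin 2 → Fin 2 × Fin 2 × Slots k → Wire k → Fin 2 := fun t x =>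
    combIndex (x.1, 0) x.2.2 (x.2.1, t)
  have h : tester s C = ∑ t, Uᴴ * C.submatrix (v t) (v t) * U := by
    ext a b
    rw [Matrix.sum_apply, tester, of_apply]
    refine Finset.sum_congr rfl fun t _ => ?_
    simp only [Matrix.mul_apply, conjTranspose_apply, submatrix_apply, U, of_apply,
      Fintype.sum_prod_type, apply_ite star, star_zero, ite_mul, zero_mul, mul_ite, mul_zero,
      Finset.sum_ite_eq', Finset.mem_univ, if_true, Fin.sum_univ_two, v]
    simp
    ring
  rw [h]
  exact posSemidef_sum _ fun t _ => (hC.submatrix _).conjTranspose_mul_mul_same _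

theorem tester_sub {k : ℕ} (s : ℝ) (C C' : CombOp k) :
    tester s (C - C') = tester s C - tester s C' := by
  ext a b
  simp only [tester, of_apply, Matrix.sub_apply, mul_sub, Finset.sum_sub_distrib]

/-- The multilinear form on slot operators with coefficients `D`: the trace of `D` against the
transpose of `x 0 ⊗ x 1 ⊗ …`. -/
noncomputable def evalAt {k : ℕ} (D : Matrix (Slots k) (Slots k) ℂ) (x : Fin k → SlotOp) : ℂ :=
  ∑ a, ∑ b, D a b * ∏ j, x j (a j) (b j)

theorem evalAt_tester {k : ℕ} (s : ℝ) (C : CombOp k) (A : QubitChannel) :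
    evalAt (tester s C) (fun _ => A.choi) = 1 / 2 * ∑ c : Fin 2, ∑ d : Fin 2,
      (s : ℂ) ^ (c : ℕ) * (s : ℂ) ^ (d : ℕ) * traceTarget (combApply C A inputState) c d := by
  simp only [evalAt, tester, traceTarget, combApply, mapOfChoi, combInsert, of_apply,
    Fintype.sum_prod_type, inputState_apply, ite_mul, zero_mul, Fin.sum_univ_two, Finset.mul_sum,
    ← Finset.sum_add_distrib]
  simp
  refine Finset.sum_congr rfl fun a _ => Finset.sum_congr rfl fun b _ => ?_
  ring

theorem ReproducesSwitch.evalAt_tester {k : ℕ} {C : CombOp k} {p : ℝ} (h : ReproducesSwitch C p)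
    {s : ℝ} (hs : s ^ 2 = 1) {J : SlotOp} (hJ : J.PosSemidef) (hJ' : OutTrace 1 J) :
    evalAt (tester s C) (fun _ => J) = p * ((1 + s * switchForm J) / 2) := by
  obtain ⟨A, n, K, hK, rfl⟩ := exists_channel_of_posSemidef hJ hJ'
  rw [SwitchSim.evalAt_tester, h A n n K K hK hK]
  have hs' : (s : ℂ) ^ 2 = 1 := by exact_mod_cast hs
  simp only [Matrix.smul_apply, traceTarget_switch hK hK, Fin.sum_univ_two]
  simp
  linear_combination (p / 4 : ℂ) * hs'

/-! ### Diagonal dominance -/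

/-- A Hermitian matrix that is diagonally dominant is positive semidefinite. The row sum includes
the diagonal entry, hence the factor two. -/
theorem posSemidef_of_sum_norm_le {n : Type*} [Fintype n] [DecidableEq n] {R : Matrix n n ℂ}
    (hR : R.IsHermitian) (h : ∀ a, ∑ b, ‖R a b‖ ≤ 2 * (R a a).re) : R.PosSemidef := by
  rw [hR.posSemidef_iff_eigenvalues_nonneg]
  intro i
  have hev : Module.End.HasEigenvalue (Matrix.toLin' R) (hR.eigenvalues i : ℂ) := by
    rw [Module.End.hasEigenvalue_iff_mem_spectrum, Matrix.spectrum_toLin']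
    exact (spectrum.algebraMap_mem_iff ℂ).mpr (hR.eigenvalues_mem_spectrum_real i)
  obtain ⟨a, ha⟩ := eigenvalue_mem_ball hev
  rw [mem_closedBall_iff_norm'] at ha
  have h1 : (R a a).re - hR.eigenvalues i ≤ ∑ b ∈ Finset.univ.erase a, ‖R a b‖ := by
    refine le_trans ?_ ha
    simpa using Complex.re_le_norm (R a a - hR.eigenvalues i)
  have h2 := h a
  rw [← Finset.add_sum_erase _ _ (Finset.mem_univ a)] at h2
  have h3 := Complex.re_le_norm (R a a)
  simp only [Pi.zero_apply]
  linarith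

/-! ### Extension from channels to their complex span -/

theorem outTrace_add_smul {t u : ℂ} {x y : SlotOp} (hx : OutTrace t x) (hy : OutTrace u y) (r : ℂ) :
    OutTrace (t + r * u) (x + r • y) := by
  intro i i'
  simp only [Matrix.add_apply, Matrix.smul_apply, smul_eq_mul, Finset.sum_add_distrib,
    ← Finset.mul_sum, hx i i', hy i i']
  split_ifs <;> simp

theorem outTrace_one : OutTrace 2 (1 : SlotOp) := by
  intro i i'
  fin_cases i <;> fin_cases i' <;> simp

/-- Along a line of slot operators, the form `evalAt D` is a polynomial. -/
theorem evalAt_line_eq_zero {k : ℕ} {D : Matrix (Slots k) (Slots k) ℂ} {x y : SlotOp}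
    (h : {r : ℂ | evalAt D (fun _ => x + r • y) = 0}.Infinite) (r : ℂ) :
    evalAt D (fun _ => x + r • y) = 0 := by
  let P : Polynomial ℂ := ∑ a, ∑ b, Polynomial.C (D a b) *
    ∏ j, (Polynomial.C (x (a j) (b j)) + Polynomial.X * Polynomial.C (y (a j) (b j)))
  have hP : ∀ r, P.eval r = evalAt D fun _ => x + r • y := by
    intro r
    simp [P, evalAt, Polynomial.eval_finsetSum, Polynomial.eval_prod, mul_comm r]
  have h0 : P = 0 := Polynomial.eq_zero_of_infinite_isRoot P <| by
    simpa only [Polynomial.IsRoot.def, hP] using h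
  rw [← hP, h0, Polynomial.eval_zero]

theorem exists_add_smul_posSemidef {x : SlotOp} (hx : x.IsHermitian) :
    ∃ R : ℝ, ∀ r : ℝ, R ≤ r → (x + (r : ℂ) • (1 : SlotOp)).PosSemidef := by
  refine ⟨∑ a, ∑ b, 3 * ‖x a b‖, fun r hr => ?_⟩
  have hr0 : 0 ≤ r := le_trans (by positivity) hr
  refine posSemidef_of_sum_norm_le (hx.add ?_) fun a => ?_
  · rw [Matrix.IsHermitian, conjTranspose_smul, conjTranspose_one]
    simp
  · have h1 : ∑ b, ‖(x + (r : ℂ) • (1 : SlotOp)) a b‖ ≤ ∑ b, ‖x a b‖ + r := by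
      calc _ ≤ ∑ b, (‖x a b‖ + if a = b then r else 0) := by
            refine Finset.sum_le_sum fun b _ => (norm_add_le _ _).trans ?_
            gcongr
            rw [Matrix.smul_apply, Matrix.one_apply]
            split_ifs <;> simp [abs_of_nonneg hr0]
        _ = _ := by simp [Finset.sum_add_distrib]
    have h2 : ∑ b, 3 * ‖x a b‖ ≤ r := le_trans
      (Finset.single_le_sum (f := fun a => ∑ b, 3 * ‖x a b‖) (fun a _ => by positivity)
        (Finset.mem_univ a)) hr
    have h3 : ‖x a a‖ ≤ ∑ b, ‖x a b‖ :=
      Finset.single_le_sum (f := fun b => ‖x a b‖) (fun b _ => norm_nonneg _) (Finset.mem_univ a)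
    have h4 := (abs_le.mp (Complex.abs_re_le_norm (x a a))).1
    rw [← Finset.mul_sum] at h2
    simp only [Matrix.add_apply, Matrix.smul_apply, Matrix.one_apply_eq, smul_eq_mul, mul_one,
      Complex.add_re, Complex.ofReal_re] at h1 ⊢
    linarith

/-- A form that vanishes on the (unnormalised) Choi operators of channels vanishes on their complex
span. Every Hermitian operator with scalar output trace becomes such a Choi operator after a large
multiple of the identity is added, and the form is polynomial along lines. -/
theorem evalAt_eq_zero_of_outTrace {k : ℕ} {D : Matrix (Slots k) (Slots k) ℂ}
    (h : ∀ (x : SlotOp) (t : ℂ), x.PosSemidef → t ≠ 0 → OutTrace t x → evalAt D (fun _ => x) = 0)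
    {x : SlotOp} {t : ℂ} (hx : OutTrace t x) : evalAt D (fun _ => x) = 0 := by
  have hherm : ∀ (x : SlotOp) (t : ℂ), x.IsHermitian → OutTrace t x →
      evalAt D (fun _ => x) = 0 := by
    intro x t hx ht
    obtain ⟨R, hR⟩ := exists_add_smul_posSemidef hx
    have := evalAt_line_eq_zero (D := D) (x := x) (y := 1) ?_ 0
    · simpa using this
    -- the value `r = -t / 2`, where the trace vanishes, is left out
    · have hinf : ((fun r : ℝ => (r : ℂ)) '' (Set.Ici R) \ {-t / 2}).Infinite :=
        ((Set.Ici_infinite R).image Complex.ofReal_injective.injOn).sdiff (Set.finite_singleton _)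
      refine hinf.mono ?_
      rintro _ ⟨⟨r, hr, rfl⟩, hne⟩
      refine h _ _ (hR r hr) ?_ (outTrace_add_smul ht outTrace_one r)
      contrapose! hne
      simp only [Set.mem_singleton_iff]
      linear_combination hne / 2
  -- `x = y + i z` with `y` and `z` Hermitian
  set y : SlotOp := (1 / 2 : ℂ) • (x + xᴴ) with hy
  set z : SlotOp := (-Complex.I / 2 : ℂ) • (x - xᴴ) with hz
  have hxs : OutTrace (star t) xᴴ := by
    intro i i'
    have h := congrArg star (hx i' i)
    simp only [star_sum, conjTranspose_apply] at h ⊢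
    rw [h]
    by_cases hii : i = i'
    · simp [hii]
    · simp [hii, Ne.symm hii]
  have hxyz : x = y + Complex.I • z := by
    ext a b
    simp only [hy, hz, Matrix.add_apply, Matrix.smul_apply, Matrix.sub_apply, smul_eq_mul]
    linear_combination (x a b - xᴴ a b) / 2 * Complex.I_mul_I
  have hyH : y.IsHermitian := by
    rw [Matrix.IsHermitian, hy, conjTranspose_smul, conjTranspose_add, conjTranspose_conjTranspose,
      add_comm]
    simp
  have hzH : z.IsHermitian := by
    rw [Matrix.IsHermitian, hz, conjTranspose_smul, conjTranspose_sub, conjTranspose_conjTranspose,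
      ← neg_sub x, smul_neg, ← neg_smul]
    simp [neg_div]
  have h0 : OutTrace 0 (0 : SlotOp) := fun i i' => by simp
  have hyT : ∃ u, OutTrace u y := by
    have h1 := outTrace_add_smul h0 (outTrace_add_smul hx hxs 1) (1 / 2)
    rw [one_smul, zero_add, zero_add] at h1
    exact ⟨_, h1⟩
  have hzT : ∃ u, OutTrace u z := by
    have h1 := outTrace_add_smul h0 (outTrace_add_smul hx hxs (-1)) (-Complex.I / 2)
    rw [neg_one_smul, ← sub_eq_add_neg, zero_add, zero_add] at h1
    exact ⟨_, h1⟩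
  obtain ⟨u, hu⟩ := hyT
  obtain ⟨v, hv⟩ := hzT
  rw [hxyz]
  refine evalAt_line_eq_zero ?_ _
  refine (Set.infinite_range_of_injective Complex.ofReal_injective).mono ?_
  rintro _ ⟨r, rfl⟩
  refine hherm _ _ (hyH.add ?_) (outTrace_add_smul hu hv r)
  rw [Matrix.IsHermitian, conjTranspose_smul, hzH.eq]
  simp

/-! ### Polarisation -/

theorem sum_sum_sum_comm {α β γ : Type*} {s : Finset α} {t : Finset β} {u : Finset γ}
    (f : α → β → γ → ℂ) :
    ∑ a ∈ s, ∑ b ∈ t, ∑ c ∈ u, f a b c = ∑ c ∈ u, ∑ a ∈ s, ∑ b ∈ t, f a b c :=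
  (Finset.sum_congr rfl fun _ _ => Finset.sum_comm).trans Finset.sum_comm

/-- The alternating sum over the subsets that contain the range of `φ` vanishes unless `φ` is
surjective. -/
theorem sum_neg_one_pow_of_not_surjective {k : ℕ} {φ : Fin k → Fin k}
    (hφ : ¬ Function.Surjective φ) :
    ∑ S : Finset (Fin k), (-1 : ℂ) ^ S.card * (if ∀ i, φ i ∈ S then 1 else 0) = 0 := by
  obtain ⟨j, hj⟩ := not_forall.mp hφ
  have hne : ∀ i, φ i ≠ j := fun i h => hj ⟨i, h⟩
  rw [← Finset.powerset_univ, ← Finset.insert_erase (Finset.mem_univ j),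
    Finset.sum_powerset_insert (Finset.notMem_erase j _), ← Finset.sum_add_distrib]
  refine Finset.sum_eq_zero fun S hS => ?_
  have hjS : j ∉ S := fun h => Finset.notMem_erase j _ (Finset.mem_powerset.mp hS h)
  simp only [Finset.card_insert_of_notMem hjS, Finset.mem_insert, hne, false_or, pow_succ]
  ring

/-- Polarisation: a form that vanishes on all constant families of operators with scalar output
trace vanishes after symmetrisation on all families of such operators. -/
theorem sum_perm_evalAt_eq_zero {k : ℕ} {D : Matrix (Slots k) (Slots k) ℂ}
    (h : ∀ (x : SlotOp) (t : ℂ), OutTrace t x → evalAt D (fun _ => x) = 0) (x : Fin k → SlotOp)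
    (hx : ∀ j, ∃ t, OutTrace t (x j)) :
    ∑ σ : Equiv.Perm (Fin k), evalAt D (fun j => x (σ j)) = 0 := by
  choose t ht using hx
  have hsum : ∀ S : Finset (Fin k), OutTrace (∑ j ∈ S, t j) (∑ j ∈ S, x j) := by
    intro S i i'
    simp only [Matrix.sum_apply]
    rw [Finset.sum_comm]
    simp only [ht _ i i']
    split_ifs <;> simp
  have hexp : ∀ S : Finset (Fin k), evalAt D (fun _ => ∑ j ∈ S, x j) =
      ∑ φ : Fin k → Fin k, (if ∀ i, φ i ∈ S then 1 else 0) * evalAt D (fun i => x (φ i)) := by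
    intro S
    have hfilter : Fintype.piFinset (fun _ : Fin k => S) =
        Finset.univ.filter fun φ : Fin k → Fin k => ∀ i, φ i ∈ S := by
      ext φ
      simp
    simp only [ite_mul, one_mul, zero_mul, ← Finset.sum_filter, ← hfilter]
    simp only [evalAt, Matrix.sum_apply, Finset.prod_univ_sum, Finset.mul_sum]
    exact sum_sum_sum_comm _
  -- Inclusion-exclusion over the subsums keeps the permutations only.
  have h0 : ∑ S : Finset (Fin k), (-1 : ℂ) ^ S.card * evalAt D (fun _ => ∑ j ∈ S, x j) = 0 :=
    Finset.sum_eq_zero fun S _ => by rw [h _ _ (hsum S), mul_zero]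
  simp only [hexp, Finset.mul_sum, ← mul_assoc] at h0
  rw [Finset.sum_comm] at h0
  simp only [← Finset.sum_mul] at h0
  rw [← Fintype.sum_of_injective (fun σ : Equiv.Perm (Fin k) => ⇑σ) DFunLike.coe_injective
    (fun σ => (-1 : ℂ) ^ k * evalAt D fun j => x (σ j))] at h0
  · rw [← Finset.mul_sum] at h0
    exact (mul_eq_zero.mp h0).resolve_left (pow_ne_zero _ (by norm_num))
  · intro φ hφ
    rw [sum_neg_one_pow_of_not_surjective, zero_mul]
    intro hs
    exact hφ ⟨Equiv.ofBijective φ (Finite.surjective_iff_bijective.mp hs), rfl⟩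
  · intro σ
    congr 1
    rw [Finset.sum_eq_single Finset.univ]
    · simp
    · intro S _ hS
      rw [if_neg, mul_zero]
      intro hall
      refine hS (Finset.eq_univ_of_forall fun i => ?_)
      simpa using hall (σ.symm i)
    · simp

/-! ### Operators in the symmetric power of the span of the channels -/

/-- An operator on the slots that is fixed by a linear map in every single slot is fixed by the
tensor power of this map. Here `f c d` is the image of the matrix unit at `c d`. -/
theorem eq_sum_of_forall_slot {α : Type*} [Fintype α] (f : α → α → α → α → ℂ) {k : ℕ}
    (X : (Fin k → α) → (Fin k → α) → ℂ)
    (h : ∀ j a b, ∑ c, ∑ d, X (Function.update a j c) (Function.update b j d) * f c d (a j) (b j) =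
      X a b) (a b : Fin k → α) :
    X a b = ∑ c, ∑ d, X c d * ∏ j, f (c j) (d j) (a j) (b j) := by
  induction k with
  | zero =>
    simp [Subsingleton.elim (default : Fin 0 → α) a, Subsingleton.elim a b]
  | succ k ih =>
    have hcons : ∀ F : (Fin (k + 1) → α) → ℂ, ∑ c, F c = ∑ c0, ∑ c', F (Fin.cons c0 c') := by
      intro F
      rw [← (Fin.consEquiv fun _ => α).sum_comp F, Fintype.sum_prod_type]
      rfl
    have hstep : ∀ c0 d0, X (Fin.cons c0 (Fin.tail a)) (Fin.cons d0 (Fin.tail b)) = ∑ c', ∑ d',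
        X (Fin.cons c0 c') (Fin.cons d0 d') *
          ∏ j, f (c' j) (d' j) (Fin.tail a j) (Fin.tail b j) := by
      intro c0 d0
      refine ih (fun c' d' => X (Fin.cons c0 c') (Fin.cons d0 d')) ?_ _ _
      intro j a' b'
      have := h j.succ (Fin.cons c0 a') (Fin.cons d0 b')
      simpa only [← Fin.cons_update, Fin.cons_succ] using this
    rw [← h 0 a b]
    simp only [hcons, Fin.prod_univ_succ, Fin.cons_zero, Fin.cons_succ]
    refine Finset.sum_congr rfl fun c0 _ => ?_
    rw [Finset.sum_comm]
    refine Finset.sum_congr rfl fun d0 _ => ?_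
    have ha : ∀ c, Function.update a 0 c = Fin.cons c (Fin.tail a) := fun c => by
      conv_lhs => rw [← Fin.cons_self_tail a, Fin.update_cons_zero]
    have hb : ∀ c, Function.update b 0 c = Fin.cons c (Fin.tail b) := fun c => by
      conv_lhs => rw [← Fin.cons_self_tail b, Fin.update_cons_zero]
    rw [ha, hb, hstep, Finset.sum_mul]
    refine Finset.sum_congr rfl fun c' _ => ?_
    rw [Finset.sum_mul]
    refine Finset.sum_congr rfl fun d' _ => ?_
    simp only [Fin.tail]
    ring

/-- The image of the matrix unit at `c d` under the projection `x ↦ x - Tr_O x ⊗ 𝟙 / 2 + Tr x / 4`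
onto the operators with scalar output trace. -/
noncomputable def slotProj (c d : Fin 2 × Fin 2) : SlotOp :=
  Matrix.of fun a b => (if c = a ∧ d = b then 1 else 0) -
    (if c.1 = a.1 ∧ d.1 = b.1 ∧ c.2 = d.2 ∧ a.2 = b.2 then 1 / 2 else 0) +
    if c = d ∧ a = b then 1 / 4 else 0

theorem outTrace_slotProj (c d : Fin 2 × Fin 2) :
    OutTrace (if c = d then 1 / 2 else 0) (slotProj c d) := by
  intro i i'
  obtain ⟨c1, c2⟩ := c
  obtain ⟨d1, d2⟩ := d
  fin_cases c1 <;> fin_cases c2 <;> fin_cases d1 <;> fin_cases d2 <;> fin_cases i <;>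
    fin_cases i' <;> simp [slotProj, Fin.sum_univ_two] <;> norm_num

theorem sum_mul_slotProj {x : SlotOp} {t : ℂ} (hx : OutTrace t x) (a b : Fin 2 × Fin 2) :
    ∑ c, ∑ d, x c d * slotProj c d a b = x a b := by
  have h0 := hx 0 0
  have h1 := hx 1 1
  have h01 := hx 0 1
  have h10 := hx 1 0
  obtain ⟨a1, a2⟩ := a
  obtain ⟨b1, b2⟩ := b
  simp only [Fin.sum_univ_two] at h0 h1 h01 h10
  simp at h0 h1 h01 h10
  fin_cases a1 <;> fin_cases a2 <;> fin_cases b1 <;> fin_cases b2 <;>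
    simp [slotProj, Fintype.sum_prod_type] <;>
    first
      | linear_combination (-1 / 4 : ℂ) * h0 + (1 / 4 : ℂ) * h1
      | linear_combination (1 / 4 : ℂ) * h0 - (1 / 4 : ℂ) * h1
      | linear_combination (-1 / 2 : ℂ) * h01
      | linear_combination (-1 / 2 : ℂ) * h10

/-- `X` lies in the tensor power of the operators with scalar output trace. -/
def SlotScalar {k : ℕ} (X : Matrix (Slots k) (Slots k) ℂ) : Prop :=
  ∀ j a b, ∃ t, OutTrace t (Matrix.of fun c d => X (Function.update a j c) (Function.update b j d))

/-- `X` is invariant under permutations of the slots. -/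
def SlotSymmetric {k : ℕ} (X : Matrix (Slots k) (Slots k) ℂ) : Prop :=
  ∀ (σ : Equiv.Perm (Fin k)) a b, X (fun j => a (σ j)) (fun j => b (σ j)) = X a b

/-- A form that vanishes on the tensor powers of channels annihilates the symmetric operators in the
tensor power of the span of the channels. -/
theorem sum_mul_eq_zero_of_symmetric {k : ℕ} {D X : Matrix (Slots k) (Slots k) ℂ}
    (h : ∀ (x : SlotOp) (t : ℂ), OutTrace t x → evalAt D (fun _ => x) = 0)
    (hX : SlotSymmetric X) (hX' : SlotScalar X) : ∑ a, ∑ b, D a b * X a b = 0 := by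
  have hexp : ∀ a b, X a b = ∑ c, ∑ d, X c d * ∏ j, slotProj (c j) (d j) (a j) (b j) := by
    refine eq_sum_of_forall_slot (fun c d => slotProj c d) X fun j a b => ?_
    obtain ⟨t, ht⟩ := hX' j a b
    have := sum_mul_slotProj ht (a j) (b j)
    simpa only [of_apply, Function.update_eq_self] using this
  have h1 : ∑ a, ∑ b, D a b * X a b =
      ∑ c, ∑ d, X c d * evalAt D fun j => slotProj (c j) (d j) := by
    calc ∑ a, ∑ b, D a b * X a b = ∑ a, ∑ b, ∑ c, ∑ d,
          X c d * (D a b * ∏ j, slotProj (c j) (d j) (a j) (b j)) := by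
          refine Finset.sum_congr rfl fun a _ => Finset.sum_congr rfl fun b _ => ?_
          rw [hexp a b]
          simp only [Finset.mul_sum]
          exact Finset.sum_congr rfl fun c _ => Finset.sum_congr rfl fun d _ => by ring
      _ = ∑ c, ∑ d, ∑ a, ∑ b, X c d * (D a b * ∏ j, slotProj (c j) (d j) (a j) (b j)) := by
          rw [sum_sum_sum_comm]
          exact Finset.sum_congr rfl fun c _ => sum_sum_sum_comm _
      _ = _ := by simp only [evalAt, Finset.mul_sum]
  -- By the symmetry of `X` the expansion may be averaged over the permutations of the slots.
  have h2 : ∀ σ : Equiv.Perm (Fin k), ∑ a, ∑ b, D a b * X a b =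
      ∑ c, ∑ d, X c d * evalAt D fun j => slotProj (c (σ j)) (d (σ j)) := by
    intro σ
    rw [h1]
    let e : Slots k ≃ Slots k := Equiv.arrowCongr σ.symm (Equiv.refl _)
    have he : ∀ c j, e c j = c (σ j) := fun c j => rfl
    rw [← e.sum_comp]
    refine Finset.sum_congr rfl fun c _ => ?_
    rw [← e.sum_comp]
    refine Finset.sum_congr rfl fun d _ => ?_
    rw [show X (e c) (e d) = X c d from hX σ c d]
    rfl
  have h3 : (Fintype.card (Equiv.Perm (Fin k)) : ℂ) * ∑ a, ∑ b, D a b * X a b = 0 := by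
    rw [← nsmul_eq_mul, ← Finset.card_univ, ← Finset.sum_const,
      Finset.sum_congr rfl fun σ _ => h2 σ, Finset.sum_comm]
    refine Finset.sum_eq_zero fun c _ => ?_
    rw [Finset.sum_comm]
    refine Finset.sum_eq_zero fun d _ => ?_
    rw [← Finset.mul_sum, sum_perm_evalAt_eq_zero h (fun j => slotProj (c j) (d j))
      (fun j => ⟨_, outTrace_slotProj _ _⟩), mul_zero]
  exact (mul_eq_zero.mp h3).resolve_left (Nat.cast_ne_zero.mpr Fintype.card_ne_zero)

/-! ### The target form -/

/-- The tensor product of operators on the slots. -/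
noncomputable def slotTensor {k : ℕ} (g : Fin k → SlotOp) : Matrix (Slots k) (Slots k) ℂ :=
  Matrix.of fun a b => ∏ j, g j (a j) (b j)

theorem evalAt_slotTensor {k : ℕ} (g x : Fin k → SlotOp) :
    evalAt (slotTensor g) x = ∏ j, ∑ a, ∑ b, g j a b * x j a b := by
  simp only [evalAt, slotTensor, of_apply, ← Finset.prod_mul_distrib, Fintype.prod_sum]

theorem evalAt_add {k : ℕ} (D D' : Matrix (Slots k) (Slots k) ℂ) (x : Fin k → SlotOp) :
    evalAt (D + D') x = evalAt D x + evalAt D' x := by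
  simp only [evalAt, Matrix.add_apply, add_mul, Finset.sum_add_distrib]

theorem evalAt_smul {k : ℕ} (r : ℂ) (D : Matrix (Slots k) (Slots k) ℂ) (x : Fin k → SlotOp) :
    evalAt (r • D) x = r * evalAt D x := by
  simp only [evalAt, Matrix.smul_apply, smul_eq_mul, mul_assoc, Finset.mul_sum]

theorem evalAt_sum {k : ℕ} {ι : Type*} (s : Finset ι) (D : ι → Matrix (Slots k) (Slots k) ℂ)
    (x : Fin k → SlotOp) : evalAt (∑ i ∈ s, D i) x = ∑ i ∈ s, evalAt (D i) x := by
  simp only [evalAt, Matrix.sum_apply, Finset.sum_mul]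
  exact (sum_sum_sum_comm _).symm ▸ rfl

theorem evalAt_const_smul {k : ℕ} (D : Matrix (Slots k) (Slots k) ℂ) (r : ℂ) (x : SlotOp) :
    evalAt D (fun _ => r • x) = r ^ k * evalAt D fun _ => x := by
  simp only [evalAt, Matrix.smul_apply, smul_eq_mul, Finset.prod_mul_distrib, Finset.prod_const,
    Finset.card_univ, Fintype.card_fin, Finset.mul_sum]
  exact Finset.sum_congr rfl fun c _ => Finset.sum_congr rfl fun d _ => by ring

/-- The operator `|0⟩⟨0| ⊗ 𝟙`, which reads off the scalar of an operator with scalar output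
trace. -/
def zeroInput : SlotOp :=
  Matrix.of fun a b => if a.1 = 0 ∧ a = b then 1 else 0

/-- The coefficients of the probability `(1 + s ⟨switch form⟩) / 2` of the control outcome as a form
on the slots, made homogeneous by `zeroInput`. -/
noncomputable def switchTarget (n : ℕ) (s : ℝ) : Matrix (Slots (n + 2)) (Slots (n + 2)) ℂ :=
  (1 / 2 : ℂ) • (slotTensor (fun _ => zeroInput) + (s : ℂ) • ∑ t, ∑ v, ∑ u,
    slotTensor (Fin.cons (Matrix.single (0, v) (u, t) 1)
      (Fin.cons (Matrix.single (v, t) (0, u) 1) fun _ => zeroInput)))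

theorem sum_zeroInput_mul {t : ℂ} {x : SlotOp} (hx : OutTrace t x) :
    ∑ a, ∑ b, zeroInput a b * x a b = t := by
  have h := hx 0 0
  simp only [zeroInput, of_apply, Fintype.sum_prod_type, Fin.sum_univ_two] at h ⊢
  simpa using h

theorem sum_single_mul (c d : Fin 2 × Fin 2) (x : SlotOp) :
    ∑ a, ∑ b, Matrix.single c d (1 : ℂ) a b * x a b = x c d := by
  simp [Matrix.single_apply, ite_and]

theorem evalAt_switchTarget (n : ℕ) (s : ℝ) {t : ℂ} {x : SlotOp} (hx : OutTrace t x) :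
    evalAt (switchTarget n s) (fun _ => x) =
      (t ^ (n + 2) + s * (switchForm x * t ^ n)) / 2 := by
  simp only [switchTarget, evalAt_smul, evalAt_add, evalAt_sum, evalAt_slotTensor,
    Fin.prod_univ_succ, Fin.cons_zero, Fin.cons_succ, sum_zeroInput_mul hx, sum_single_mul,
    Finset.prod_const, Finset.card_univ, Fintype.card_fin, ← mul_assoc, ← Finset.sum_mul]
  rw [switchForm]
  ring

theorem outTrace_nonneg {x : SlotOp} (hx : x.PosSemidef) {t : ℂ} (ht : OutTrace t x) : 0 ≤ t := by
  have h := ht 0 0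
  rw [if_pos rfl] at h
  rw [← h]
  exact Finset.sum_nonneg fun o _ => hx.diag_nonneg

/-- The condition on a restricted simulation is linear in the symmetric power of the span of the
channels. -/
theorem ReproducesSwitch.sum_tester_mul {n : ℕ} {C : CombOp (n + 2)} {p : ℝ}
    (hC : ReproducesSwitch C p) {s : ℝ} (hs : s ^ 2 = 1)
    {X : Matrix (Slots (n + 2)) (Slots (n + 2)) ℂ}
    (hX : SlotSymmetric X)
    (hX' : SlotScalar X) :
    ∑ a, ∑ b, tester s C a b * X a b = p * ∑ a, ∑ b, switchTarget n s a b * X a b := by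
  have hD : ∀ (x : SlotOp) (t : ℂ), OutTrace t x →
      evalAt (tester s C + (-p : ℂ) • switchTarget n s) (fun _ => x) = 0 := by
    refine fun x t => evalAt_eq_zero_of_outTrace fun x t hx ht0 ht => ?_
    rw [evalAt_add, evalAt_smul, evalAt_switchTarget n s ht]
    have hJ : (t⁻¹ • x).PosSemidef := hx.smul (inv_nonneg.mpr (outTrace_nonneg hx ht))
    have hJ' : OutTrace 1 (t⁻¹ • x) := fun i i' => by
      simp only [Matrix.smul_apply, smul_eq_mul, ← Finset.mul_sum, ht i i']
      split_ifs <;> simp [ht0]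
    have h := hC.evalAt_tester hs hJ hJ'
    have hq : switchForm (t⁻¹ • x) = t⁻¹ ^ 2 * switchForm x := by
      simp only [switchForm, Matrix.smul_apply, smul_eq_mul, Finset.mul_sum]
      exact Finset.sum_congr rfl fun _ _ => Finset.sum_congr rfl fun _ _ =>
        Finset.sum_congr rfl fun _ _ => by ring
    rw [evalAt_const_smul, hq] at h
    have h' : evalAt (tester s C) (fun _ => x) =
        t ^ (n + 2) * (p * ((1 + s * (t⁻¹ ^ 2 * switchForm x)) / 2)) := by
      rw [← h, ← mul_assoc, ← mul_pow, mul_inv_cancel₀ ht0, one_pow, one_mul]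
    rw [h']
    field_simp
    ring
  have h := sum_mul_eq_zero_of_symmetric hD hX hX'
  simp only [Matrix.add_apply, Matrix.smul_apply, smul_eq_mul, add_mul, Finset.sum_add_distrib,
    mul_assoc, ← Finset.mul_sum] at h
  linear_combination h

/-! ### Trace-and-replace -/

/-- The integral kernel of trace-and-replace, a product over the systems. -/
noncomputable def traceKernel {k : ℕ} (X : Finset (Wire k)) (a b c d : Wire k → Fin 2) : ℂ :=
  ∏ w, if w ∈ X then (if a w = b w ∧ c w = d w then 1 / 2 else 0)
    else (if a w = c w ∧ b w = d w then 1 else 0)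

theorem traceKernel_comm {k : ℕ} (X : Finset (Wire k)) (a b c d : Wire k → Fin 2) :
    traceKernel X a b c d = traceKernel X c d a b := by
  refine Finset.prod_congr rfl fun w _ => ?_
  simp only [and_comm, eq_comm]

theorem traceReplace_eq_sum {k : ℕ} (X : Finset (Wire k)) (C : CombOp k) (a b : Wire k → Fin 2) :
    traceReplace X C a b = ∑ c, ∑ d, traceKernel X a b c d * C c d := by
  rw [← Fintype.sum_prod_type' (f := fun c d => traceKernel X a b c d * C c d), traceReplace,
    of_apply]
  have hinj : Function.Injective fun x : X → Fin 2 =>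
      (Function.updateFinset a X x, Function.updateFinset b X x) := by
    intro x y h
    funext w
    have := congrFun (congrArg Prod.fst h) w
    simpa [Function.updateFinset] using this
  rw [← Fintype.sum_of_injective _ hinj (fun x =>
    (if ∀ w ∈ X, a w = b w then 1 / 2 ^ X.card else 0) *
      C (Function.updateFinset a X x) (Function.updateFinset b X x))]
  · split_ifs
    · rw [Finset.mul_sum]
    · simp
  · rintro ⟨c, d⟩ hcd
    by_contra hne
    refine hcd ⟨fun w => c w, ?_⟩
    have hne' := Finset.prod_ne_zero_iff.mp (left_ne_zero_of_mul hne)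
    have hc : Function.updateFinset a X (fun w => c w) = c := by
      funext w
      have := hne' w (Finset.mem_univ w)
      by_cases hw : w ∈ X
      · simp [Function.updateFinset, hw]
      · simp only [hw, if_false, ne_eq, ite_eq_right_iff, not_forall] at this
        simp [Function.updateFinset, hw, this.1.1]
    have hd : Function.updateFinset b X (fun w => c w) = d := by
      funext w
      have := hne' w (Finset.mem_univ w)
      by_cases hw : w ∈ X
      · simp only [hw, if_true, ne_eq, ite_eq_right_iff, not_forall] at this
        simp [Function.updateFinset, hw, this.1.2]
      · simp only [hw, if_false, ne_eq, ite_eq_right_iff, not_forall] at this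
        simp [Function.updateFinset, hw, this.1.2]
    simp only [hc, hd]
  · intro x
    dsimp only
    congr 1
    have hfac : ∀ w, (if w ∈ X then (if a w = b w ∧ Function.updateFinset a X x w =
          Function.updateFinset b X x w then (1 / 2 : ℂ) else 0)
        else (if a w = Function.updateFinset a X x w ∧ b w = Function.updateFinset b X x w
          then 1 else 0)) = if w ∈ X then (if a w = b w then 1 / 2 else 0) else 1 := by
      intro w
      by_cases hw : w ∈ X <;> simp [Function.updateFinset, hw]
    rw [traceKernel, Finset.prod_congr rfl fun w _ => hfac w, Finset.prod_ite_mem,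
      Finset.univ_inter]
    split_ifs with h
    · rw [Finset.prod_congr rfl fun w hw => if_pos (h w hw), Finset.prod_const, one_div, one_div,
        inv_pow]
    · obtain ⟨w, hw⟩ := not_forall.mp h
      obtain ⟨hwX, hw⟩ := Classical.not_imp.mp hw
      exact (Finset.prod_eq_zero hwX (if_neg hw)).symm

/-- The bilinear pairing `Tr (C Mᵀ)`. -/
noncomputable def pairing {n : Type*} [Fintype n] (C M : Matrix n n ℂ) : ℂ :=
  ∑ a, ∑ b, C a b * M a b

theorem pairing_traceReplace {k : ℕ} (X : Finset (Wire k)) (C M : CombOp k) :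
    pairing (traceReplace X C) M = pairing C (traceReplace X M) := by
  simp only [pairing, traceReplace_eq_sum, Finset.mul_sum, Finset.sum_mul]
  calc ∑ a, ∑ b, ∑ c, ∑ d, traceKernel X a b c d * C c d * M a b
      = ∑ c, ∑ d, ∑ a, ∑ b, traceKernel X a b c d * C c d * M a b := by
        rw [sum_sum_sum_comm]
        exact Finset.sum_congr rfl fun c _ => sum_sum_sum_comm _
    _ = _ := by
        refine Finset.sum_congr rfl fun c _ => Finset.sum_congr rfl fun d _ =>
          Finset.sum_congr rfl fun a _ => Finset.sum_congr rfl fun b _ => ?_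
        rw [traceKernel_comm]
        ring

theorem sum_traceKernel_mul {k : ℕ} (X Y : Finset (Wire k)) (a b e f : Wire k → Fin 2) :
    ∑ c, ∑ d, traceKernel X a b c d * traceKernel Y c d e f = traceKernel (X ∪ Y) a b e f := by
  let F : Wire k → Fin 2 → Fin 2 → ℂ := fun w u v =>
    (if w ∈ X then (if a w = b w ∧ u = v then 1 / 2 else 0)
      else (if a w = u ∧ b w = v then 1 else 0)) *
    (if w ∈ Y then (if u = v ∧ e w = f w then 1 / 2 else 0)
      else (if u = e w ∧ v = f w then 1 else 0))
  have hF : ∑ c, ∑ d, traceKernel X a b c d * traceKernel Y c d e f =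
      ∏ w, ∑ u, ∑ v, F w u v := by
    simp only [traceKernel, ← Finset.prod_mul_distrib, Fintype.prod_sum, F]
  rw [hF, traceKernel]
  refine Finset.prod_congr rfl fun w _ => ?_
  simp only [F, Finset.mem_union]
  generalize a w = p
  generalize b w = q
  generalize e w = r
  generalize f w = s
  by_cases hX : w ∈ X <;> by_cases hY : w ∈ Y <;>
    simp only [hX, hY, if_true, if_false, or_true, true_or, or_self, Fin.sum_univ_two] <;>
    fin_cases p <;> fin_cases q <;> fin_cases r <;> fin_cases s <;> simp <;> norm_num

theorem traceReplace_traceReplace {k : ℕ} (X Y : Finset (Wire k)) (C : CombOp k) :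
    traceReplace X (traceReplace Y C) = traceReplace (X ∪ Y) C := by
  ext a b
  simp only [traceReplace_eq_sum, ← sum_traceKernel_mul, Finset.mul_sum, Finset.sum_mul]
  calc ∑ c, ∑ d, ∑ e, ∑ f, traceKernel X a b c d * (traceKernel Y c d e f * C e f)
      = ∑ e, ∑ f, ∑ c, ∑ d, traceKernel X a b c d * (traceKernel Y c d e f * C e f) := by
        rw [sum_sum_sum_comm]
        exact Finset.sum_congr rfl fun c _ => sum_sum_sum_comm _
    _ = _ := by simp only [mul_assoc]

theorem traceReplace_smul {k : ℕ} (X : Finset (Wire k)) (r : ℂ) (C : CombOp k) :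
    traceReplace X (r • C) = r • traceReplace X C := by
  ext a b
  simp only [traceReplace_eq_sum, Matrix.smul_apply, smul_eq_mul, Finset.mul_sum, mul_left_comm]

theorem traceReplace_sum {k : ℕ} (X : Finset (Wire k)) {ι : Type*} (s : Finset ι)
    (C : ι → CombOp k) : traceReplace X (∑ i ∈ s, C i) = ∑ i ∈ s, traceReplace X (C i) := by
  ext a b
  simp only [traceReplace_eq_sum, Matrix.sum_apply, Finset.mul_sum]
  exact (sum_sum_sum_comm _)

theorem wiresFrom_union (k m n : ℕ) : wiresFrom k m ∪ wiresFrom k n = wiresFrom k (min m n) := by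
  ext w
  simp [wiresFrom]

/-- An operator that is the identity on the systems in `X` is fixed by trace-and-replace. -/
theorem traceReplace_eq_self {k : ℕ} {X : Finset (Wire k)} {M : CombOp k}
    (h0 : ∀ a b, (¬ ∀ w ∈ X, a w = b w) → M a b = 0)
    (h1 : ∀ a b x, (∀ w ∈ X, a w = b w) →
      M (Function.updateFinset a X x) (Function.updateFinset b X x) = M a b) :
    traceReplace X M = M := by
  ext a b
  rw [traceReplace, of_apply]
  split_ifs with h
  · rw [Finset.sum_congr rfl fun x _ => h1 a b x h, Finset.sum_const, Finset.card_univ,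
      Fintype.card_fun, Fintype.card_fin, Fintype.card_coe, nsmul_eq_mul]
    push_cast
    field_simp
  · exact (h0 a b h).symm

theorem traceReplace_singleton {k : ℕ} (w : Wire k) (M : CombOp k) (a b : Wire k → Fin 2) :
    traceReplace {w} M a b = if a w = b w then
      1 / 2 * ∑ v, M (Function.update a w v) (Function.update b w v) else 0 := by
  rw [traceReplace, of_apply]
  simp only [Finset.mem_singleton, forall_eq, Finset.card_singleton, pow_one,
    Function.updateFinset_singleton]
  congr 2
  let e : (({w} : Finset (Wire k)) → Fin 2) ≃ Fin 2 :=
    Equiv.funUnique _ _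
  exact e.sum_comp fun v => M (Function.update a w v) (Function.update b w v)

/-! ### Combs and their dual -/

theorem sum_ite_neg_one_pow (j l : ℕ) :
    ∑ m ∈ Finset.range (2 * (j + l) + 2), (if 2 * j + 1 ≤ m then (-1 : ℂ) ^ m else 0) = -1 := by
  induction l with
  | zero =>
    rw [add_zero, Finset.sum_range_succ, Finset.sum_eq_zero, if_pos le_rfl, pow_succ, pow_mul]
    · simp
    · intro m hm
      exact if_neg (by simpa using hm)
  | succ l ih =>
    rw [show 2 * (j + (l + 1)) + 2 = 2 * (j + l) + 2 + 1 + 1 by ring, Finset.sum_range_succ,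
      Finset.sum_range_succ, ih, if_pos (by omega), if_pos (by omega), pow_succ]
    ring

/-- In a comb, tracing out what comes from the input of slot `j` on leaves the identity on the
output of the slot before (for `j = k` the global future takes the part of the input, for `j = 0`
the global past the part of the output). -/
theorem IsComb.traceReplace_eq {k : ℕ} {C : CombOp k} (hC : IsComb C) {j : ℕ} (hj : j ≤ k) :
    traceReplace (wiresFrom k (2 * j + 1)) C = traceReplace (wiresFrom k (2 * j)) C := by
  have h0 : ∑ m ∈ Finset.range (2 * k + 2), (-1 : ℂ) ^ m • traceReplace (wiresFrom k m) C = 0 := by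
    simpa [combProj] using hC.proj_eq
  have h1 : ∀ n, ∑ m ∈ Finset.range (2 * k + 2),
      (-1 : ℂ) ^ m • traceReplace (wiresFrom k (min n m)) C = 0 := by
    intro n
    have h := congrArg (traceReplace (wiresFrom k n)) h0
    rw [traceReplace_sum] at h
    simp only [traceReplace_smul, traceReplace_traceReplace, wiresFrom_union] at h
    rw [h]
    ext a b
    simp [traceReplace_eq_sum]
  -- The identities `h1` for `2 j + 1` and for `2 j` differ in the terms with `m ≥ 2 j + 1` only.
  have h2 : ∑ m ∈ Finset.range (2 * k + 2), (if 2 * j + 1 ≤ m then (-1 : ℂ) ^ m else 0) •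
      (traceReplace (wiresFrom k (2 * j + 1)) C - traceReplace (wiresFrom k (2 * j)) C) = 0 := by
    rw [← sub_self (0 : CombOp k)]
    nth_rewrite 1 [← h1 (2 * j + 1)]
    rw [← h1 (2 * j), ← Finset.sum_sub_distrib]
    refine Finset.sum_congr rfl fun m _ => ?_
    split_ifs with hm
    · rw [min_eq_left hm, min_eq_left (by omega), smul_sub]
    · rw [min_eq_right (by omega), min_eq_right (by omega), sub_self, zero_smul]
  obtain ⟨l, rfl⟩ := Nat.exists_eq_add_of_le hj
  rw [← Finset.sum_smul, sum_ite_neg_one_pow, neg_one_smul, neg_eq_zero, sub_eq_zero] at h2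
  exact h2

/-- The slot part of a basis vector of all systems. -/
def slotsOf {k : ℕ} (w : Wire k → Fin 2) : Slots k := fun j => (w (.slotIn j), w (.slotOut j))

/-- A dual comb with value `Ω 0`: `Ω n` is an operator on the first `n` slots (encoded as an
operator on all slots that does not look at the later ones), and tracing out the last output of
`Ω (n + 1)` leaves the identity on the last input, tensored with `Ω n`. -/
structure DualComb {k : ℕ} (Ω : ℕ → Matrix (Slots k) (Slots k) ℂ) : Prop where
  congr : ∀ n a a' b b', (∀ j : Fin k, (j : ℕ) < n → a j = a' j) →
    (∀ j : Fin k, (j : ℕ) < n → b j = b' j) → Ω n a b = Ω n a' b'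
  outTrace : ∀ (n : Fin k) a b i i', ∑ o, Ω (n + 1) (Function.update a n (i, o))
    (Function.update b n (i', o)) = if i = i' then Ω n a b else 0

/-- The operator `|+⟩⟨+| ⊗ |0⟩⟨0|` on the global past, `Ω n` on the first `n` slots and the identity
on all later systems, up to normalisation. -/
noncomputable def liftOp {k : ℕ} (Ω : ℕ → Matrix (Slots k) (Slots k) ℂ) (n : ℕ) : CombOp k :=
  Matrix.of fun w w' =>
    if (w .targIn = 0 ∧ w' .targIn = 0) ∧ ∀ v ∈ wiresFrom k (2 * n + 1), w v = w' v
    then 1 / 2 * Ω n (slotsOf w) (slotsOf w') else 0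

theorem mem_wiresFrom {k m : ℕ} {w : Wire k} : w ∈ wiresFrom k m ↔ m ≤ w.time := by
  simp [wiresFrom]

theorem DualComb.traceReplace_liftOp {k : ℕ} {Ω : ℕ → Matrix (Slots k) (Slots k) ℂ}
    (h : DualComb Ω) (n : ℕ) :
    traceReplace (wiresFrom k (2 * n + 1)) (liftOp Ω n) = liftOp Ω n := by
  refine traceReplace_eq_self (fun a b hab => ?_) fun a b x hab => ?_
  · rw [liftOp, of_apply, if_neg (fun h => hab h.2)]
  · have ht : (Wire.targIn : Wire k) ∉ wiresFrom k (2 * n + 1) := by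
      simp [mem_wiresFrom, Wire.time]
    have hs : ∀ a : Wire k → Fin 2, ∀ j : Fin k, (j : ℕ) < n →
        slotsOf (Function.updateFinset a (wiresFrom k (2 * n + 1)) x) j = slotsOf a j := by
      intro a j hj
      have h1 : Wire.slotIn j ∉ wiresFrom k (2 * n + 1) := by
        simp only [mem_wiresFrom, Wire.time]
        omega
      have h2 : Wire.slotOut j ∉ wiresFrom k (2 * n + 1) := by
        simp only [mem_wiresFrom, Wire.time]
        omega
      simp [slotsOf, Function.updateFinset, h1, h2]
    have hx : ∀ v ∈ wiresFrom k (2 * n + 1),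
        Function.updateFinset a (wiresFrom k (2 * n + 1)) x v =
          Function.updateFinset b (wiresFrom k (2 * n + 1)) x v := by
      intro v hv
      simp [Function.updateFinset, hv]
    rw [liftOp, of_apply, of_apply, h.congr n _ _ _ _ (hs a) (hs b)]
    have e1 : Function.updateFinset a (wiresFrom k (2 * n + 1)) x .targIn = a .targIn := by
      simp [Function.updateFinset, ht]
    have e2 : Function.updateFinset b (wiresFrom k (2 * n + 1)) x .targIn = b .targIn := by
      simp [Function.updateFinset, ht]
    rw [e1, e2]
    simp only [eq_true hx, eq_true hab]

theorem slotsOf_update {k : ℕ} (a : Wire k → Fin 2) (j : Fin k) (v : Fin 2) :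
    slotsOf (Function.update a (.slotOut j) v) =
      Function.update (slotsOf a) j (a (.slotIn j), v) := by
  funext i
  by_cases hij : i = j
  · subst hij
    simp [slotsOf]
  · simp [slotsOf, hij]

theorem DualComb.traceReplace_liftOp_succ {k : ℕ} {Ω : ℕ → Matrix (Slots k) (Slots k) ℂ}
    (h : DualComb Ω) (n : Fin k) :
    traceReplace (wiresFrom k (2 * (n + 1))) (liftOp Ω (n + 1)) = (1 / 2 : ℂ) • liftOp Ω n := by
  have hw : wiresFrom k (2 * (n + 1)) =
      {Wire.slotOut n} ∪ wiresFrom k (2 * ((n : ℕ) + 1) + 1) := by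
    ext w
    simp only [Finset.mem_union, Finset.mem_singleton, mem_wiresFrom]
    constructor
    · intro hw
      by_contra hcon
      rw [not_or] at hcon
      have ht : w.time = 2 * ((n : ℕ) + 1) := by omega
      cases w with
      | ctrlIn => simp [Wire.time] at ht
      | targIn => simp [Wire.time] at ht
      | slotIn j => simp only [Wire.time] at ht; omega
      | slotOut j =>
        simp only [Wire.time] at ht
        exact hcon.1 (congrArg Wire.slotOut (Fin.ext (by omega)))
      | ctrlOut => simp only [Wire.time] at ht; omega
      | targOut => simp only [Wire.time] at ht; omega
    · rintro (rfl | hw)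
      · simp only [Wire.time]
        omega
      · omega
  have hw' : ∀ a b : Wire k → Fin 2, (∀ v ∈ wiresFrom k (2 * n + 1), a v = b v) ↔
      a (.slotIn n) = b (.slotIn n) ∧ a (.slotOut n) = b (.slotOut n) ∧
        ∀ v ∈ wiresFrom k (2 * ((n : ℕ) + 1) + 1), a v = b v := by
    intro a b
    constructor
    · intro hab
      refine ⟨hab _ ?_, hab _ ?_, fun v hv => hab v ?_⟩
      · simp [mem_wiresFrom, Wire.time]
      · simp [mem_wiresFrom, Wire.time]
      · rw [mem_wiresFrom] at hv ⊢
        omega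
    · rintro ⟨h1, h2, h3⟩ v hv
      rw [mem_wiresFrom] at hv
      by_cases hv' : 2 * ((n : ℕ) + 1) + 1 ≤ v.time
      · exact h3 v (mem_wiresFrom.mpr hv')
      · cases v with
        | ctrlIn => simp [Wire.time] at hv
        | targIn => simp [Wire.time] at hv
        | slotIn j =>
          simp only [Wire.time] at hv hv'
          obtain rfl : j = n := Fin.ext (by omega)
          exact h1
        | slotOut j =>
          simp only [Wire.time] at hv hv'
          obtain rfl : j = n := Fin.ext (by omega)
          exact h2
        | ctrlOut => simp only [Wire.time] at hv'; omega
        | targOut => simp only [Wire.time] at hv'; omega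
  rw [hw, ← traceReplace_traceReplace, h.traceReplace_liftOp]
  ext a b
  have hO : Wire.slotOut n ∉ wiresFrom k (2 * ((n : ℕ) + 1) + 1) := by
    simp only [mem_wiresFrom, Wire.time]
    omega
  have hupd : ∀ u, (∀ v ∈ wiresFrom k (2 * ((n : ℕ) + 1) + 1),
      Function.update a (.slotOut n) u v = Function.update b (.slotOut n) u v) ↔
      ∀ v ∈ wiresFrom k (2 * ((n : ℕ) + 1) + 1), a v = b v := by
    intro u
    refine forall₂_congr fun v hv => ?_
    have hne : v ≠ .slotOut n := fun h => hO (h ▸ hv)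
    rw [Function.update_of_ne hne, Function.update_of_ne hne]
  rw [traceReplace_singleton, Matrix.smul_apply]
  simp only [liftOp, of_apply, hupd, hw' a b, slotsOf_update]
  have ht : ∀ (c : Wire k → Fin 2) (u : Fin 2),
      Function.update c (.slotOut n) u .targIn = c .targIn := fun c u =>
    Function.update_of_ne (by simp) _ _
  simp only [ht]
  have hsum := h.outTrace n (slotsOf a) (slotsOf b) (a (.slotIn n)) (b (.slotIn n))
  by_cases h1 : (a .targIn = 0 ∧ b .targIn = 0) ∧
      ∀ v ∈ wiresFrom k (2 * ((n : ℕ) + 1) + 1), a v = b v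
  · simp only [if_pos h1, ← Finset.mul_sum, hsum]
    by_cases h2 : a (.slotOut n) = b (.slotOut n) <;>
      by_cases h3 : a (.slotIn n) = b (.slotIn n)
    · rw [if_pos h2, if_pos h3, if_pos ⟨h1.1, h3, h2, h1.2⟩]
      rfl
    · rw [if_pos h2, if_neg h3, if_neg (fun h => h3 h.2.1)]
      simp
    · rw [if_neg h2, if_neg (fun h => h2 h.2.2.1)]
      simp
    · rw [if_neg h2, if_neg (fun h => h2 h.2.2.1)]
      simp
  · have h2 : ¬ ((a .targIn = 0 ∧ b .targIn = 0) ∧ a (.slotIn n) = b (.slotIn n) ∧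
        a (.slotOut n) = b (.slotOut n) ∧
        ∀ v ∈ wiresFrom k (2 * ((n : ℕ) + 1) + 1), a v = b v) := fun h => h1 ⟨h.1, h.2.2.2⟩
    rw [if_neg h2]
    simp only [if_neg h1]
    simp

theorem sum_ite_eq_zero_mul_two {W : Type*} [Fintype W] [DecidableEq W] (t : W) :
    (∑ a : W → Fin 2, if a t = 0 then (1 : ℂ) else 0) * 2 = 2 ^ Fintype.card W := by
  have h1 : ∀ a : W → Fin 2, (if a t = 0 then (1 : ℂ) else 0) =
      ∏ w, if w = t then (if a w = 0 then 1 else 0) else 1 := by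
    intro a
    rw [Finset.prod_ite_eq' Finset.univ t]
    simp
  have h2 : (2 : ℂ) = ∏ w : W, if w = t then 2 else 1 := by
    rw [Finset.prod_ite_eq' Finset.univ t]
    simp
  simp only [h1]
  rw [← Fintype.prod_sum fun (w : W) (v : Fin 2) =>
    if w = t then (if v = 0 then (1 : ℂ) else 0) else 1]
  nth_rewrite 1 [h2]
  rw [← Finset.prod_mul_distrib, ← Finset.card_univ, ← Finset.prod_const]
  refine Finset.prod_congr rfl fun w _ => ?_
  split_ifs <;> norm_num

/-- A comb pairs with a dual comb to the value of the dual comb. -/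
theorem IsComb.pairing_liftOp {k : ℕ} {C : CombOp k} (hC : IsComb C)
    {Ω : ℕ → Matrix (Slots k) (Slots k) ℂ} (h : DualComb Ω) (a b : Slots k) :
    pairing C (liftOp Ω k) = Ω 0 a b := by
  have hstep : ∀ n : Fin k, pairing C (liftOp Ω (n + 1)) = 1 / 2 * pairing C (liftOp Ω n) := by
    intro n
    rw [← h.traceReplace_liftOp, ← pairing_traceReplace, hC.traceReplace_eq (by omega),
      pairing_traceReplace, h.traceReplace_liftOp_succ]
    simp only [pairing, Matrix.smul_apply, smul_eq_mul, Finset.mul_sum, mul_left_comm]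
  have hall : ∀ n, n ≤ k → pairing C (liftOp Ω n) = (1 / 2) ^ n * pairing C (liftOp Ω 0) := by
    intro n
    induction n with
    | zero => simp
    | succ n ih =>
      intro hn
      rw [hstep ⟨n, hn⟩, ih (by omega), pow_succ]
      ring
  -- After all slots are traced out, only the trace of the comb is left.
  have h0 : pairing C (liftOp Ω 0) = 2 ^ k * Ω 0 a b := by
    have huniv : wiresFrom k (2 * 0) = Finset.univ := by simp [wiresFrom]
    have hconst : ∀ c d, Ω 0 c d = Ω 0 a b := fun c d =>
      h.congr 0 _ _ _ _ (fun j hj => absurd hj (by omega)) (fun j hj => absurd hj (by omega))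
    have hT : ∀ c d, traceReplace Finset.univ C c d =
        if c = d then 1 / 2 ^ Fintype.card (Wire k) * C.trace else 0 := by
      intro c d
      rw [traceReplace, of_apply]
      have hcond : (∀ w ∈ Finset.univ, c w = d w) ↔ c = d := by simp [funext_iff]
      simp only [hcond, Function.updateFinset_univ, Finset.card_univ]
      congr 2
      exact (Equiv.piCongrLeft (fun _ => Fin 2)
        (Equiv.subtypeUnivEquiv (p := (· ∈ (Finset.univ : Finset (Wire k))))
          Finset.mem_univ)).sum_comp fun x => C x x
    rw [← h.traceReplace_liftOp, ← pairing_traceReplace, hC.traceReplace_eq (Nat.zero_le k), huniv]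
    have hdiag : ∀ c, liftOp Ω 0 c c = (if c .targIn = 0 then 1 else 0) * (1 / 2 * Ω 0 a b) := by
      intro c
      rw [liftOp, of_apply, hconst]
      simp
    have hsum : ∑ c, liftOp Ω 0 c c =
        (∑ c : Wire k → Fin 2, if c .targIn = 0 then 1 else 0) * (1 / 2 * Ω 0 a b) := by
      simp only [hdiag, Finset.sum_mul]
    simp only [pairing, hT, ite_mul, zero_mul, Finset.sum_ite_eq, Finset.mem_univ, if_true,
      ← Finset.mul_sum]
    rw [hsum, hC.trace_eq]
    have hcount := sum_ite_eq_zero_mul_two (Wire.targIn : Wire k)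
    rw [show ((2 : ℂ) * 2 * 2 ^ k) = 4 * 2 ^ k by norm_num]
    have hne : (2 : ℂ) ^ Fintype.card (Wire k) ≠ 0 := pow_ne_zero _ two_ne_zero
    field_simp
    linear_combination 2 * Ω 0 a b * hcount
  rw [hall k le_rfl, h0, ← mul_assoc, ← mul_pow]
  norm_num

/-- Basis vectors of all systems as triples: slots, global past, global future. -/
def combIndexEquiv (k : ℕ) : Slots k × (Fin 2 × Fin 2) × (Fin 2 × Fin 2) ≃ (Wire k → Fin 2) where
  toFun x := combIndex x.2.1 x.1 x.2.2
  invFun w := (slotsOf w, (w .ctrlIn, w .targIn), (w .ctrlOut, w .targOut))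
  left_inv _ := rfl
  right_inv w := by
    funext v
    cases v <;> rfl

theorem slotsOf_combIndex {k : ℕ} (p : Fin 2 × Fin 2) (a : Slots k) (f : Fin 2 × Fin 2) :
    slotsOf (combIndex p a f) = a := rfl

theorem liftOp_combIndex {k : ℕ} (Ω : ℕ → Matrix (Slots k) (Slots k) ℂ) (p q f g : Fin 2 × Fin 2)
    (a b : Slots k) : liftOp Ω k (combIndex p a f) (combIndex q b g) =
      if p.2 = 0 ∧ q.2 = 0 ∧ f = g then 1 / 2 * Ω k a b else 0 := by
  have hw : wiresFrom k (2 * k + 1) = {Wire.ctrlOut, Wire.targOut} := by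
    ext w
    rw [mem_wiresFrom]
    cases w <;> simp [Wire.time]
    all_goals omega
  rw [liftOp, of_apply, hw]
  simp only [Finset.mem_insert, Finset.mem_singleton, forall_eq_or_imp, forall_eq, combIndex,
    slotsOf_combIndex, and_assoc, Prod.ext_iff]

/-- Both control outcomes together are the pairing with the lifted operator. -/
theorem pairing_tester_add {k : ℕ} (C : CombOp k) (Ω : ℕ → Matrix (Slots k) (Slots k) ℂ) :
    pairing (tester 1 C) (Ω k) + pairing (tester (-1) C) (Ω k) = pairing C (liftOp Ω k) := by
  have hre : pairing C (liftOp Ω k) = ∑ x : Slots k × (Fin 2 × Fin 2) × (Fin 2 × Fin 2),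
      ∑ y : Slots k × (Fin 2 × Fin 2) × (Fin 2 × Fin 2),
        C (combIndex x.2.1 x.1 x.2.2) (combIndex y.2.1 y.1 y.2.2) *
          liftOp Ω k (combIndex x.2.1 x.1 x.2.2) (combIndex y.2.1 y.1 y.2.2) := by
    rw [pairing, ← (combIndexEquiv k).sum_comp]
    exact Finset.sum_congr rfl fun x _ => ((combIndexEquiv k).sum_comp _).symm
  rw [hre]
  simp only [liftOp_combIndex, Fintype.sum_prod_type, Fin.sum_univ_two, pairing, tester, of_apply,
    ← Finset.sum_add_distrib]
  refine Finset.sum_congr rfl fun a _ => Finset.sum_congr rfl fun b _ => ?_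
  simp
  ring

/-! ### Weak duality -/

theorem pairing_nonneg {n : Type*} [Fintype n] {A B : Matrix n n ℂ} (hA : A.PosSemidef)
    (hB : B.PosSemidef) : 0 ≤ pairing A B := by
  have h := (hA.hadamard hB).dotProduct_mulVec_nonneg fun _ => 1
  simpa [dotProduct, mulVec, pairing, hadamard_apply] using h

theorem pairing_sub_right {n : Type*} [Fintype n] (A B C : Matrix n n ℂ) :
    pairing A (B - C) = pairing A B - pairing A C := by
  simp only [pairing, Matrix.sub_apply, mul_sub, Finset.sum_sub_distrib]

theorem pairing_sub_left {n : Type*} [Fintype n] (A B C : Matrix n n ℂ) :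
    pairing (A - B) C = pairing A C - pairing B C := by
  simp only [pairing, Matrix.sub_apply, sub_mul, Finset.sum_sub_distrib]

/-- Weak duality for the semidefinite program of restricted simulations: a dual comb above two
symmetric operators in the span of the channels bounds the success probability. -/
theorem RestrictedSimulable.mul_le {n : ℕ} {p : ℝ} (h : RestrictedSimulable (n + 2) p)
    {Ω : ℕ → Matrix (Slots (n + 2)) (Slots (n + 2)) ℂ}
    {X : ℝ → Matrix (Slots (n + 2)) (Slots (n + 2)) ℂ} {Φ lam : ℝ} (hΩ : DualComb Ω)
    (hΩ0 : ∀ a b, Ω 0 a b = lam) (hpos : (Ω (n + 2)).PosSemidef)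
    (hdom : ∀ s : ℝ, s ^ 2 = 1 → (Ω (n + 2) - X s).PosSemidef)
    (hsymm : ∀ s : ℝ, s ^ 2 = 1 → SlotSymmetric (X s))
    (hscal : ∀ s : ℝ, s ^ 2 = 1 → SlotScalar (X s))
    (hΦ : pairing (switchTarget n 1) (X 1) + pairing (switchTarget n (-1)) (X (-1)) = Φ) :
    p * Φ ≤ lam := by
  obtain ⟨Cs, ⟨C, hC, hCs, hCf⟩, hrep⟩ := h
  have hX : ∀ s : ℝ, s ^ 2 = 1 →
      pairing (tester s Cs) (X s) = p * pairing (switchTarget n s) (X s) := fun s hs =>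
    hrep.sum_tester_mul hs (hsymm s hs) (hscal s hs)
  -- `Cs ≤ C` with `Ω ≥ 0`, and `X s ≤ Ω` with `Cs ≥ 0`
  have hle : ∀ s : ℝ, s ^ 2 = 1 →
      pairing (tester s Cs) (X s) ≤ pairing (tester s C) (Ω (n + 2)) := by
    intro s hs
    have h1 := pairing_nonneg (posSemidef_tester s hCs) (hdom s hs)
    have h2 := pairing_nonneg (posSemidef_tester s hCf) hpos
    rw [pairing_sub_right, sub_nonneg] at h1
    rw [tester_sub, pairing_sub_left, sub_nonneg] at h2
    exact h1.trans h2
  have hp : (1 : ℝ) ^ 2 = 1 := one_pow 2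
  have hm : (-1 : ℝ) ^ 2 = 1 := by norm_num
  have hsum := add_le_add (hle 1 hp) (hle (-1) hm)
  rw [pairing_tester_add, hC.pairing_liftOp hΩ 0 0, hΩ0, hX 1 hp, hX (-1) hm, ← mul_add, hΦ] at hsum
  exact_mod_cast hsum

/-! ### Operators given by integer matrices -/

/-- The number with base four digits `2 i + o`, for the first `n` slots; slot `0` is the most
significant one. -/
def code {k : ℕ} : ℕ → Slots k → ℕ
  | 0, _ => 0
  | n + 1, a => 4 * code n a + if h : n < k then 2 * ((a ⟨n, h⟩).1 : ℕ) + ((a ⟨n, h⟩).2 : ℕ) else 0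

theorem code_congr {k n : ℕ} {a b : Slots k} (h : ∀ j : Fin k, (j : ℕ) < n → a j = b j) :
    code n a = code n b := by
  induction n with
  | zero => rfl
  | succ n ih =>
    rw [code, code, ih fun j hj => h j (by omega)]
    split_ifs with hn
    · rw [h ⟨n, hn⟩ (Nat.lt_succ_self n)]
    · rfl

theorem code_lt {k n : ℕ} (a : Slots k) : code n a < 4 ^ n := by
  induction n with
  | zero => simp [code]
  | succ n ih =>
    rw [code, pow_succ]
    split_ifs with hn
    · have h1 := (a ⟨n, hn⟩).1.is_lt
      have h2 := (a ⟨n, hn⟩).2.is_lt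
      omega
    · omega

theorem code_update {k : ℕ} (n : Fin k) (a : Slots k) (u : Fin 2 × Fin 2) :
    code (n + 1) (Function.update a n u) = 4 * code n a + (2 * u.1 + u.2) := by
  rw [code, dif_pos n.is_lt, Fin.eta, Function.update_self]
  congr 2
  refine code_congr fun j hj => Function.update_of_ne ?_ _ _
  rintro rfl
  exact absurd hj (lt_irrefl _)

/-- The operator on the slots with the entries `Y`, indexed by the codes of the basis vectors. -/
def ofCode (k : ℕ) (Y : ℕ → ℕ → ℤ) : Matrix (Slots k) (Slots k) ℂ :=
  Matrix.of fun a b => (Y (code k a) (code k b) : ℂ)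

/-- The partial trace over the last slot, conditional on its input being `0`. -/
def reduceLast (Y : ℕ → ℕ → ℤ) (m n : ℕ) : ℤ :=
  Y (4 * m) (4 * n) + Y (4 * m + 1) (4 * n + 1)

/-- The partial trace over the output of the last slot is the identity on its input, tensored with
`reduceLast Y`; the other slots have `N` basis vectors. -/
def LastScalar (N : ℕ) (Y : ℕ → ℕ → ℤ) : Prop :=
  ∀ m < N, ∀ n < N, Y (4 * m) (4 * n + 2) + Y (4 * m + 1) (4 * n + 3) = 0 ∧
    Y (4 * m + 2) (4 * n) + Y (4 * m + 3) (4 * n + 1) = 0 ∧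
    Y (4 * m + 2) (4 * n + 2) + Y (4 * m + 3) (4 * n + 3) = reduceLast Y m n

instance (N : ℕ) (Y : ℕ → ℕ → ℤ) : Decidable (LastScalar N Y) := by
  unfold LastScalar
  infer_instance

theorem LastScalar.sum_eq {N : ℕ} {Y : ℕ → ℕ → ℤ} (h : LastScalar N Y) {m n : ℕ} (hm : m < N)
    (hn : n < N) (i i' : Fin 2) :
    ∑ o : Fin 2, (Y (4 * m + (2 * i + o)) (4 * n + (2 * i' + o)) : ℂ) =
      if i = i' then (reduceLast Y m n : ℂ) else 0 := by
  obtain ⟨h1, h2, h3⟩ := h m hm n hn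
  fin_cases i <;> fin_cases i' <;> simp [Fin.sum_univ_two]
  · exact_mod_cast rfl
  · exact_mod_cast h1
  · exact_mod_cast h2
  · exact_mod_cast h3

/-- The reductions of `Y` to the first slots. -/
def reductions (k : ℕ) (Y : ℕ → ℕ → ℤ) (n : ℕ) : Matrix (Slots k) (Slots k) ℂ :=
  Matrix.of fun a b => ((reduceLast^[k - n] Y) (code n a) (code n b) : ℂ)

theorem reductions_self (k : ℕ) (Y : ℕ → ℕ → ℤ) : reductions k Y k = ofCode k Y := by
  ext a b
  simp [reductions, ofCode]

theorem dualComb_reductions {k : ℕ} {Y : ℕ → ℕ → ℤ}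
    (h : ∀ n < k, LastScalar (4 ^ n) (reduceLast^[k - (n + 1)] Y)) :
    DualComb (reductions k Y) := by
  refine ⟨fun n a a' b b' ha hb => ?_, fun n a b i i' => ?_⟩
  · simp only [reductions, of_apply, code_congr ha, code_congr hb]
  · simp only [reductions, of_apply, code_update]
    rw [(h n n.is_lt).sum_eq (code_lt a) (code_lt b), ← Function.iterate_succ_apply' reduceLast,
      show (k - ((n : ℕ) + 1)).succ = k - n by omega]

/-- Invariance under the transpositions of neighbouring slots suffices. -/
theorem slotSymmetric_of_swap {k : ℕ} {X : Matrix (Slots (k + 1)) (Slots (k + 1)) ℂ}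
    (h : ∀ (i : Fin k) a b, X (fun j => a (Equiv.swap i.castSucc i.succ j))
      (fun j => b (Equiv.swap i.castSucc i.succ j)) = X a b) : SlotSymmetric X := by
  intro σ
  have hσ : σ ∈ Submonoid.closure (Set.range fun i : Fin k => Equiv.swap i.castSucc i.succ) := by
    rw [Equiv.Perm.mclosure_swap_castSucc_succ]
    trivial
  induction hσ using Submonoid.closure_induction with
  | mem τ hτ =>
    obtain ⟨i, rfl⟩ := hτ
    exact h i
  | one => exact fun a b => rfl
  | mul τ υ _ _ hτ hυ =>
    intro a b
    rw [← hτ a b, ← hυ (fun j => a (τ j)) (fun j => b (τ j))]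
    rfl

/-- For a symmetric operator it suffices to look at the last slot. -/
theorem slotScalar_ofCode {k : ℕ} {Y : ℕ → ℕ → ℤ} (h : LastScalar (4 ^ k) Y)
    (hs : SlotSymmetric (ofCode (k + 1) Y)) : SlotScalar (ofCode (k + 1) Y) := by
  intro j a b
  let σ := Equiv.swap j (Fin.last k)
  have hupd : ∀ (a : Slots (k + 1)) c, (fun i => Function.update a j c (σ i)) =
      Function.update (fun i => a (σ i)) (Fin.last k) c := by
    intro a c
    funext i
    by_cases hi : i = Fin.last k
    · subst hi
      simp [σ]
    · rw [Function.update_of_ne hi, Function.update_of_ne]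
      intro hj
      apply hi
      rw [← σ.injective.eq_iff, hj, Equiv.swap_apply_right]
  refine ⟨reduceLast Y (code k fun i => a (σ i)) (code k fun i => b (σ i)), fun i i' => ?_⟩
  simp only [of_apply, ← hs σ (Function.update a j _), hupd]
  simp only [ofCode, of_apply]
  have hc := fun (a : Slots (k + 1)) u => code_update (Fin.last k) a u
  simp only [Fin.val_last] at hc
  simp only [hc]
  exact h.sum_eq (code_lt _) (code_lt _) i i'

/-! ### The target value of an integer matrix -/

/-- Adjoin a basis vector for a new slot `0`. -/
def consSlot {k : ℕ} (x : Fin 2 × Fin 2) (a : Slots k) : Slots (k + 1) := Fin.cons x a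

theorem code_consSlot {k n : ℕ} (x : Fin 2 × Fin 2) (a : Slots k) :
    code (n + 1) (consSlot x a) = 4 ^ n * (2 * x.1 + x.2) + code n a := by
  induction n with
  | zero => simp [code, consSlot]
  | succ n ih =>
    rw [code, ih]
    conv_rhs => rw [code]
    by_cases hn : n < k
    · rw [dif_pos hn, dif_pos (Nat.succ_lt_succ hn)]
      change _ + (2 * ((a ⟨n, hn⟩).1 : ℕ) + ((a ⟨n, hn⟩).2 : ℕ)) = _
      ring
    · rw [dif_neg hn, dif_neg fun h => hn (Nat.lt_of_succ_lt_succ h)]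
      ring

theorem pairing_slotTensor_cons {k : ℕ} (g : SlotOp) (g' : Fin k → SlotOp)
    (X : Matrix (Slots (k + 1)) (Slots (k + 1)) ℂ) :
    pairing (slotTensor (Fin.cons g g' : Fin (k + 1) → SlotOp)) X = ∑ x, ∑ y, g x y *
      pairing (slotTensor g') (X.submatrix (consSlot x) (consSlot y)) := by
  have hcons : ∀ F : Slots (k + 1) → ℂ, ∑ c, F c = ∑ x, ∑ c', F (consSlot x c') := by
    intro F
    rw [← (Fin.consEquiv fun _ => Fin 2 × Fin 2).sum_comp F, Fintype.sum_prod_type]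
    rfl
  simp only [pairing, hcons, slotTensor, of_apply, Fin.prod_univ_succ, Fin.cons_zero, consSlot,
    Fin.cons_succ, Finset.mul_sum, submatrix_apply]
  refine Finset.sum_congr rfl fun x _ => ?_
  rw [Finset.sum_comm]
  exact Finset.sum_congr rfl fun y _ => Finset.sum_congr rfl fun a _ =>
    Finset.sum_congr rfl fun b _ => by ring

theorem pairing_slotTensor_cons_single {k : ℕ} (x y : Fin 2 × Fin 2) (g' : Fin k → SlotOp)
    (X : Matrix (Slots (k + 1)) (Slots (k + 1)) ℂ) :
    pairing (slotTensor (Fin.cons (Matrix.single x y 1) g' : Fin (k + 1) → SlotOp)) X =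
      pairing (slotTensor g') (X.submatrix (consSlot x) (consSlot y)) := by
  rw [pairing_slotTensor_cons]
  exact sum_single_mul x y fun x y =>
    pairing (slotTensor g') (X.submatrix (consSlot x) (consSlot y))

theorem pairing_slotTensor_zeroInput_succ {k : ℕ}
    (X : Matrix (Slots (k + 1)) (Slots (k + 1)) ℂ) :
    pairing (slotTensor fun _ => zeroInput) X = ∑ o, pairing (slotTensor fun _ => zeroInput)
      (X.submatrix (consSlot (0, o)) (consSlot (0, o))) := by
  have h : (fun _ : Fin (k + 1) => zeroInput) = Fin.cons zeroInput fun _ => zeroInput := by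
    funext j
    refine Fin.cases rfl (fun _ => rfl) j
  rw [h, pairing_slotTensor_cons]
  simp [zeroInput, Fintype.sum_prod_type, Fin.sum_univ_two]

theorem pairing_slotTensor_zero (g : Fin 0 → SlotOp) (X : Matrix (Slots 0) (Slots 0) ℂ) :
    pairing (slotTensor g) X = X Fin.elim0 Fin.elim0 := by
  simp only [pairing, slotTensor, of_apply, Finset.univ_unique, Finset.sum_singleton,
    Fin.prod_univ_zero, one_mul]
  exact congrArg₂ X (Subsingleton.elim _ _) (Subsingleton.elim _ _)

/-- Twice the pairing of the target form with `Y`, for two slots. The first sum is over the outputs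
for input `0`, the second one runs over the terms of the switch form. -/
def targetSumTwo (s : ℤ) (Y : ℕ → ℕ → ℤ) : ℤ :=
  ∑ u : Fin 2, ∑ v : Fin 2, Y (4 * u + v) (4 * u + v) +
    s * ∑ t : Fin 2, ∑ v : Fin 2, ∑ u : Fin 2, Y (4 * v + (2 * v + t)) (4 * (2 * u + t) + u)

/-- Twice the pairing of the target form with `Y`, for three slots; in the last slot, the input is
`0` throughout. -/
def targetSumThree (s : ℤ) (Y : ℕ → ℕ → ℤ) : ℤ :=
  ∑ u : Fin 2, ∑ v : Fin 2, ∑ w : Fin 2, Y (16 * u + 4 * v + w) (16 * u + 4 * v + w) +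
    s * ∑ t : Fin 2, ∑ v : Fin 2, ∑ u : Fin 2, ∑ w : Fin 2,
      Y (16 * v + 4 * (2 * v + t) + w) (16 * (2 * u + t) + 4 * u + w)

theorem pairing_switchTarget (n : ℕ) (s : ℝ) (X : Matrix (Slots (n + 2)) (Slots (n + 2)) ℂ) :
    pairing (switchTarget n s) X = 1 / 2 * (pairing (slotTensor fun _ => zeroInput) X +
      s * ∑ t, ∑ v, ∑ u, pairing (slotTensor (Fin.cons (Matrix.single (0, v) (u, t) 1)
        (Fin.cons (Matrix.single (v, t) (0, u) 1) fun _ => zeroInput))) X) := by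
  have hadd : ∀ A B : Matrix (Slots (n + 2)) (Slots (n + 2)) ℂ,
      pairing (A + B) X = pairing A X + pairing B X := fun A B => by
    simp only [pairing, Matrix.add_apply, add_mul, Finset.sum_add_distrib]
  have hsmul : ∀ (r : ℂ) (A : Matrix (Slots (n + 2)) (Slots (n + 2)) ℂ),
      pairing (r • A) X = r * pairing A X := fun r A => by
    simp only [pairing, Matrix.smul_apply, smul_eq_mul, mul_assoc, Finset.mul_sum]
  simp only [switchTarget, hsmul, hadd, Fin.sum_univ_two]

theorem pairing_switchTarget_two (s : ℤ) (Y : ℕ → ℕ → ℤ) :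
    pairing (switchTarget 0 s) (ofCode 2 Y) = (targetSumTwo s Y : ℂ) / 2 := by
  rw [pairing_switchTarget]
  simp only [pairing_slotTensor_cons_single]
  rw [pairing_slotTensor_zeroInput_succ]
  simp only [pairing_slotTensor_zeroInput_succ, pairing_slotTensor_zero, submatrix_apply]
  have hc : ∀ (x y : Fin 2 × Fin 2) (a : Slots 0), code 2 (consSlot x (consSlot y a)) =
      4 * (2 * x.1 + x.2) + (2 * y.1 + y.2) := by
    intros
    rw [code_consSlot (n := 1), code_consSlot (n := 0), code]
    ring
  simp [ofCode, hc, targetSumTwo, Fin.sum_univ_two]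
  ring

theorem pairing_switchTarget_three (s : ℤ) (Y : ℕ → ℕ → ℤ) :
    pairing (switchTarget 1 s) (ofCode 3 Y) = (targetSumThree s Y : ℂ) / 2 := by
  rw [pairing_switchTarget]
  simp only [pairing_slotTensor_cons_single]
  rw [pairing_slotTensor_zeroInput_succ]
  simp only [pairing_slotTensor_zeroInput_succ, pairing_slotTensor_zero, submatrix_apply]
  have hc : ∀ (x y z : Fin 2 × Fin 2) (a : Slots 0),
      code 3 (consSlot x (consSlot y (consSlot z a))) =
        16 * (2 * x.1 + x.2) + 4 * (2 * y.1 + y.2) + (2 * z.1 + z.2) := by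
    intros
    rw [code_consSlot (n := 2), code_consSlot (n := 1), code_consSlot (n := 0), code]
    ring
  simp [ofCode, hc, targetSumThree, Fin.sum_univ_two]
  ring

/-! ### Positivity of integer matrices from approximate Cholesky factors -/

/-- The number of slots plus the sum of the outputs minus the sum of the inputs of a basis vector,
given by its code. All matrices of the certificates vanish between basis vectors of different
charge. -/
def charge : ℕ → ℕ → ℕ
  | 0, _ => 0
  | k + 1, a => charge k (a / 4) + (1 + a % 2 - a / 2 % 2)

/-- The entry `i` of row `a` of the list of rows `D`, and `0` beyond the ends of the lists. -/
def rowEntry (D : List (List ℤ)) (a i : ℕ) : ℤ := (D.getD a []).getD i 0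

/-- The symmetric matrix with the rows `D`, which list the entries on and below the diagonal that
belong to equal charges; `R` gives the position of a basis vector among those of its charge. -/
def entry (k : ℕ) (R : List ℕ) (D : List (List ℤ)) (a b : ℕ) : ℤ :=
  if charge k a = charge k b then rowEntry D (max a b) (R.getD (min a b) 0) else 0

theorem entry_comm (k : ℕ) (R : List ℕ) (D : List (List ℤ)) (a b : ℕ) :
    entry k R D a b = entry k R D b a := by
  simp only [entry, max_comm a b, min_comm a b, eq_comm (a := charge k a)]

theorem entry_of_ne {k : ℕ} {R : List ℕ} {D : List (List ℤ)} {a b : ℕ}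
    (h : charge k a ≠ charge k b) :
    entry k R D a b = 0 :=
  if_neg h

/-- The inner product of the rows `a` and `b` of the lower triangular factor with the rows `L`. -/
def gram (R : List ℕ) (L : List (List ℤ)) (a b : ℕ) : ℤ :=
  ∑ i ∈ Finset.range (min (R.getD a 0) (R.getD b 0) + 1),
    rowEntry L a i * rowEntry L b i

theorem gram_comm (R : List ℕ) (L : List (List ℤ)) (a b : ℕ) : gram R L a b = gram R L b a := by
  simp only [gram, min_comm (R.getD a 0), mul_comm (rowEntry L a _)]

/-- The Gram matrices of the charges together form a matrix `V Vᴴ`; the columns of `V` are indexed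
by a charge and a position. -/
theorem posSemidef_gram (k N : ℕ) (R : List ℕ) (L : List (List ℤ)) :
    (Matrix.of fun a b : Fin N =>
      ((if charge k a = charge k b then gram R L a b else 0 : ℤ) : ℂ)).PosSemidef := by
  let B := (Finset.univ.sup fun a : Fin N => charge k a) + 1
  let M := (Finset.univ.sup fun a : Fin N => R.getD a 0) + 1
  have hB : ∀ a : Fin N, charge k a < B := fun a => Nat.lt_succ_of_le
    (Finset.le_sup (f := fun a : Fin N => charge k a) (Finset.mem_univ a))
  have hM : ∀ a : Fin N, R.getD a 0 < M := fun a => Nat.lt_succ_of_le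
    (Finset.le_sup (f := fun a : Fin N => R.getD a 0) (Finset.mem_univ a))
  let v : Fin N → ℕ → ℤ := fun a i => if i ≤ R.getD a 0 then rowEntry L a i else 0
  let V : Matrix (Fin N) (Fin B × Fin M) ℂ :=
    Matrix.of fun a x => ((if (x.1 : ℕ) = charge k a then v a x.2 else 0 : ℤ) : ℂ)
  have hv : ∀ a b : Fin N, ∑ i : Fin M, v a i * v b i = gram R L a b := by
    intro a b
    rw [Fin.sum_univ_eq_sum_range fun i => v a i * v b i]
    have hsub : Finset.range (min (R.getD a 0) (R.getD b 0) + 1) ⊆ Finset.range M :=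
      Finset.range_subset_range.2 (Nat.succ_le_of_lt ((min_le_left _ _).trans_lt (hM a)))
    rw [gram, ← Finset.sum_subset hsub]
    · refine Finset.sum_congr rfl fun i hi => ?_
      have hi' := Nat.lt_succ_iff.1 (Finset.mem_range.1 hi)
      simp only [v, if_pos (hi'.trans (min_le_left _ _)), if_pos (hi'.trans (min_le_right _ _))]
    · intro i _ hi
      simp only [v]
      split_ifs with h1 h2
      · exact absurd (Finset.mem_range.2 (Nat.lt_succ_of_le (le_min h1 h2))) hi
      all_goals simp
  have hV : (Matrix.of fun a b : Fin N =>
      ((if charge k a = charge k b then gram R L a b else 0 : ℤ) : ℂ)) = V * Vᴴ := by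
    ext a b
    rw [mul_apply, Fintype.sum_prod_type, Finset.sum_eq_single ⟨charge k a, hB a⟩]
    · simp only [V, of_apply, conjTranspose_apply]
      rw [← hv]
      split_ifs with h
      · push_cast
        simp
      · simp
    · intro c _ hc
      refine Finset.sum_eq_zero fun i _ => ?_
      have : (c : ℕ) ≠ charge k a := fun h => hc (Fin.ext h)
      simp [V, this]
    · simp
  rw [hV]
  exact posSemidef_self_mul_conjTranspose V

/-- Between basis vectors of equal charge, `s Y` is the product of the lower triangular factor `L`
with its transpose, up to an error matrix with dominant diagonal. -/
def HasFactor (k : ℕ) (Y : ℕ → ℕ → ℤ) (R : List ℕ) (L : List (List ℤ)) (s : ℤ) : Prop :=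
  ∀ a < 4 ^ k, ∑ b ∈ Finset.range (4 ^ k),
    (if charge k a = charge k b then |s * Y a b - gram R L a b| else 0) ≤
      2 * (s * Y a a - gram R L a a)

instance (k : ℕ) (Y : ℕ → ℕ → ℤ) (R : List ℕ) (L : List (List ℤ)) (s : ℤ) :
    Decidable (HasFactor k Y R L s) := by
  unfold HasFactor
  infer_instance

theorem HasFactor.posSemidef {k : ℕ} {Y : ℕ → ℕ → ℤ} {R : List ℕ} {L : List (List ℤ)} {s : ℤ}
    (h : HasFactor k Y R L s) (hs : 0 < s) (hY : ∀ a b, Y a b = Y b a)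
    (hY0 : ∀ a b, charge k a ≠ charge k b → Y a b = 0) : (ofCode k Y).PosSemidef := by
  let E : Matrix (Fin (4 ^ k)) (Fin (4 ^ k)) ℂ := Matrix.of fun a b =>
    ((if charge k a = charge k b then s * Y a b - gram R L a b else 0 : ℤ) : ℂ)
  have hE : E.PosSemidef := by
    refine posSemidef_of_sum_norm_le ?_ fun a => ?_
    · ext a b
      simp only [E, conjTranspose_apply, of_apply, hY b, gram_comm R L b, eq_comm (a := charge k b),
        star_intCast]
    · have ha := h a a.is_lt
      rw [← Fin.sum_univ_eq_sum_range fun b =>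
        if charge k a = charge k b then |s * Y a b - gram R L a b| else 0] at ha
      simp only [E, of_apply, if_pos, Complex.intCast_re, Complex.norm_intCast]
      refine le_trans (le_of_eq ?_) (le_trans (Int.cast_le.2 ha) (le_of_eq ?_))
      · push_cast
        refine Finset.sum_congr rfl fun b _ => ?_
        split_ifs <;> simp
      · push_cast
        ring
  have hsum := ((posSemidef_gram k (4 ^ k) R L).add hE).submatrix
    fun a : Slots k => (⟨code k a, code_lt a⟩ : Fin (4 ^ k))
  have heq : ofCode k Y = (1 / s : ℂ) • (((Matrix.of fun a b : Fin (4 ^ k) =>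
      ((if charge k a = charge k b then gram R L a b else 0 : ℤ) : ℂ)) + E).submatrix
        fun a : Slots k => (⟨code k a, code_lt a⟩ : Fin (4 ^ k))) fun a : Slots k =>
          (⟨code k a, code_lt a⟩ : Fin (4 ^ k)) := by
    ext a b
    have hs' : (s : ℂ) ≠ 0 := by exact_mod_cast hs.ne'
    simp only [ofCode, E, of_apply, Matrix.smul_apply, submatrix_apply, Matrix.add_apply,
      smul_eq_mul]
    split_ifs with hc
    · push_cast
      field_simp
      ring
    · simp [hY0 _ _ hc]
  rw [heq]
  refine hsum.smul ?_
  have h0 : (0 : ℝ) ≤ 1 / s := by positivity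
  rw [show (1 / s : ℂ) = ((1 / s : ℝ) : ℂ) by push_cast; rfl]
  exact Complex.zero_le_real.2 h0

/-! ### The certificates -/

/-- The rows of the dual comb for two calls, in units of `1 / 10 ^ 7`. -/
def twoOmega : List (List ℤ) :=
  [([2016753] : List ℤ),
   ([13] : List ℤ),
   ([942087] : List ℤ),
   ([25, 1074679] : List ℤ),
   ([-26, 1983825] : List ℤ),
   ([13] : List ℤ),
   ([15, 345132, 896927] : List ℤ),
   ([-15, 41, 1086911] : List ℤ),
   ([-9, 11] : List ℤ),
   ([2016720, 9, 10, 2016715] : List ℤ),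
   ([1008205] : List ℤ),
   ([64, 1, 1008521] : List ℤ),
   ([-26, -5, -13, -26, 15] : List ℤ),
   ([-26, 1983832, 13, 1983863] : List ℤ),
   ([17486, -1, -16, 987161] : List ℤ),
   ([1, -17538, -90920, 1, 1, 996717] : List ℤ)]

/-- The rows of the operator `X` below `twoOmega` for the control outcome `+`. -/
def twoPlus : List (List ℤ) :=
  [([-497274301] : List ℤ),
   ([-3880240127] : List ℤ),
   ([-1872998115] : List ℤ),
   ([251041033, -2504516313] : List ℤ),
   ([1753845714, -3880240127] : List ℤ),
   ([-3155671849] : List ℤ),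
   ([500299076, 43574088, -4364577541] : List ℤ),
   ([-500299076, 2628676869, -2671334435] : List ℤ),
   ([545483584, -1872998115] : List ℤ),
   ([500299076, -545483584, 3367452762, -4364577541] : List ℤ),
   ([-3508629949] : List ℤ),
   ([-240466984, 1369681681, -2728945707] : List ℤ),
   ([251041033, -841009991, -545483584, 43574088, -2504516313] : List ℤ),
   ([2628676869, -500299076, 545483584, -2671334435] : List ℤ),
   ([1369681681, -240466984, 35115286, -2728945707] : List ℤ),
   ([-240512438, 1510036221, 240466984, 240466984, 1510036221, -2446905041] : List ℤ)]

/-- The rows of the operator `X` below `twoOmega` for the control outcome `-`. -/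
def twoMinus : List (List ℤ) :=
  [([-6797767184] : List ℤ),
   ([-4445962146] : List ℤ),
   ([-5787461836] : List ℤ),
   ([319107501, -5456267494] : List ℤ),
   ([-1523773686, -4445962146] : List ℤ),
   ([-1945919052] : List ℤ),
   ([-230252805, 588808928, -2881599742] : List ℤ),
   ([230252805, -2693919101, -3510281456] : List ℤ),
   ([-588636414, -5787461836] : List ℤ),
   ([-230252805, 588636414, -2883056185, -2881599742] : List ℤ),
   ([-4302400132] : List ℤ),
   ([260119351, -1209742959, -4366661446] : List ℤ),
   ([319107501, 597875787, 588636414, 588808928, -5456267494] : List ℤ),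
   ([-2693919101, 230252805, -588636414, -3510281456] : List ℤ),
   ([-1209742959, 260119351, -23316186, -4366661446] : List ℤ),
   ([-195768011, -1165068641, -260119351, -260119351, -1165068641, -4599887504] : List ℤ)]

/-- The rows of a lower triangular factor of `10 ^ 11 * twoOmega`, up to rounding. -/
def twoFactorOmega : List (List ℤ) :=
  [([449082201] : List ℤ),
   ([907283] : List ℤ),
   ([306933581] : List ℤ),
   ([5567, 327822243] : List ℤ),
   ([-2865698, 445391750] : List ℤ),
   ([907283] : List ℤ),
   ([3340, 105280226, 280371712] : List ℤ),
   ([-1653287, -1432, 329678464] : List ℤ),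
   ([-2932, 789401] : List ℤ),
   ([449075914, -4881, 49, 1358772] : List ℤ),
   ([263762204] : List ℤ),
   ([20851, 126756, 317571420] : List ℤ),
   ([-5790, -1525, -4064, -32, 1011489] : List ℤ),
   ([-2865698, 445394392, -8493, 1202600] : List ℤ),
   ([5696998, -105517, -5370, 314138753] : List ℤ),
   ([223, -5349851, -30419497, -18109, -31421, 314193022] : List ℤ)]

/-- The rows of a factor of `10 ^ 11 * (twoOmega - twoPlus)`, up to rounding. -/
def twoFactorPlus : List (List ℤ) :=
  [([7066053012] : List ℤ),
   ([19698325145] : List ℤ),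
   ([13670918777] : List ℤ),
   ([-3552775610, 15425202897] : List ℤ),
   ([-8903527214, 17576962134] : List ℤ),
   ([17750132005] : List ℤ),
   ([-7080318534, -1911007511, 19564370327] : List ℤ),
   ([2539805071, -13668713478, 8599871870] : List ℤ),
   ([-3990101923, 13072065607] : List ℤ),
   ([-7051777777, 1912128832, -19577426164, 1912371] : List ℤ),
   ([18720678818] : List ℤ),
   ([1758967718, -9941023204, 13060532647] : List ℤ),
   ([-3552776332, 4633895708, 1955032432, 1619405208, 14488333183] : List ℤ),
   ([-13344672076, -3902059961, -8603806195, 1878178] : List ℤ),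
   ([-10018815980, -1218583129, 152924890, 13061710543] : List ℤ),
   ([3403773487, -9005556257, -877394736, -727348343, -6507771431, 10414149604] : List ℤ)]

/-- The rows of a factor of `10 ^ 11 * (twoOmega - twoMinus)`, up to rounding. -/
def twoFactorMinus : List (List ℤ) :=
  [([26076395317] : List ℤ),
   ([21085450325] : List ℤ),
   ([24048708745] : List ℤ),
   ([-1223740751, 23328880704] : List ℤ),
   ([7226659315, 19813379110] : List ℤ),
   ([13931687138] : List ℤ),
   ([882993286, -2476150719, 16773153145] : List ℤ),
   ([-1091998589, 13994756494, 12413346284] : List ℤ),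
   ([2447684037, 23921852511] : List ℤ),
   ([890727120, -2476484927, 16776032572, 1864852] : List ℤ),
   ([20732603158] : List ℤ),
   ([-1081635150, 5167735109, 20208700501] : List ℤ),
   ([-1223740947, -2627006484, -3832788689, 1270760971, 22823736381] : List ℤ),
   ([12776198912, -5812039104, 12418352179, 1846344] : List ℤ),
   ([5030459048, -1602087861, 794306591, 20193111053] : List ℤ),
   ([750747983, 5033410419, 2253805243, -815895653, 6148141229, 19764731564] : List ℤ)]

/-- The position of each basis vector of two slots among those of the same charge. -/
def twoRank : List ℕ :=
  [0, 0, 0, 1, 1, 0, 2, 2, 1, 3, 0, 2, 4, 3, 3, 5]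

/-- The rows of the dual comb for three calls, in units of `1 / 10 ^ 8`. -/
def threeOmega : List (List ℤ) :=
  [([24072102] : List ℤ),
   ([5455794] : List ℤ),
   ([17663802] : List ℤ),
   ([-12887423, 11864094] : List ℤ),
   ([-571896, 7631710] : List ℤ),
   ([562390] : List ℤ),
   ([-1054934, 650972, 6479918] : List ℤ),
   ([1054934, -1171359, 1714182] : List ℤ),
   ([7104749, 8931586] : List ℤ),
   ([12017900, -7104749, -1712037, 12831818] : List ℤ),
   ([343154] : List ℤ),
   ([814568, -4765327, 21420250] : List ℤ),
   ([-13662698, 4937050, -38095, -4425626, 13129686] : List ℤ),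
   ([-360396, 3165692, 38095, 2828906] : List ℤ),
   ([-10326328, -2909020, -801090, 9331618] : List ℤ),
   ([5792774, -3696766, 2340948, 2909020, -1210375, 6626974] : List ℤ),
   ([1553555, 3014560, -1622576, 777045, 11428800] : List ℤ),
   ([-1831884, 6082892] : List ℤ),
   ([1505591, -4290433, 187680, 5170450, 351577, -765245, 13608776] : List ℤ),
   ([-1505591, -1482808, 994996, -351577, -3640247, 3902916] : List ℤ),
   ([-66059, 1252980, 10097368] : List ℤ),
   ([160] : List ℤ),
   ([-3806924, -96863, 41617, -934568, 507028, -820588, 8238740] : List ℤ),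
   ([96863, -507028, -2626163, 1858788] : List ℤ),
   ([-1013873, 1546423, 296652, 1733387, 1420168, 450642, -1861473, 4517128] : List ℤ),
   ([725131, -330796, -296652, 1879368, 4354386, 1861473, -5836205, 11358208] : List ℤ),
   ([-88895, 1391051, 3160179, 2442704, 3973524] : List ℤ),
   ([2465333, -199847, 1527572, -1391051, -3728180, 856832, 2149110, -1436623, 11901812] : List ℤ),
   ([-2742122, -1086471, -805721, -276739, -2528326, 1266700, 981003, -566154, 4290444] : List ℤ),
   ([1375213, -3815048, 6119442, -981003, 7443440] : List ℤ),
   ([-491142, 1810528, 385943, -2523916, 706693, -1801483, -4875744, -115270, -4480926,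
    8384300] : List ℤ),
   ([491142, -1186481, -97201, -706693, 3967722, -1467630, 2256746, 115270, 259629,
    3349584] : List ℤ),
   ([3682673, 2580130, 21059, -3630672, -1740021, 5360654] : List ℤ),
   ([9524187, -3682673, -533819, 3635060, -6114301, 3630672, -1413662, -78440, 1740021, -770202,
    5117546] : List ℤ),
   ([703452, 4881498] : List ℤ),
   ([3946749, -2412883, 5511738, -4003875, -1211038, -370081, 5596702] : List ℤ),
   ([12811511, -8673011, 331727, 4320769, -7510978, 2082619, 3672502, -2225543, 4027603, -597423,
    4377650, 12867886] : List ℤ),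
   ([6269485, 6569503, -331727, 1295788, 5232291, -3672502, -3447846, -1887185, -3235256, 597423,
    16136062] : List ℤ),
   ([7577269, 5113080, -13001697, -4868276, -4056469, 1758058, 123910, 15086838] : List ℤ),
   ([-10679293, 11503727, 120657, -5113080, 3901207, -1346914, -5123923, 1417181, -56259, -349010,
    -1758058, -7848409, 13917110] : List ℤ),
   ([-5927, -25303, 542] : List ℤ),
   ([15723392, 11018593, 5927, -10175361, 83622, 8796992, 25303, 5641693, 23367838] : List ℤ),
   ([1381998] : List ℤ),
   ([1702099, 3839160, -78133, 21986382] : List ℤ),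
   ([-654461, 461585, -89793, 1229607, 784770, -290006, -841720, -594423, -262556,
    286906] : List ℤ),
   ([-8161654, 654461, -785864, -1270129, 10289729, -1229607, 6880777, -1501871, -784770, -790726,
    -4800332, 752512, 594423, 15826862] : List ℤ),
   ([-604529, -1763788, 14024, -3232100, 1178070] : List ℤ),
   ([-1644822, -1828117, -204015, 2818171, 3142111, 208620, -3326550, -6383188, -14024, 647179,
    14935698] : List ℤ),
   ([-13428204, 4959828, 783429, -7514329, 4940935, -4654655, 635949, -642178, -2137759, -835688,
    -6004523, -5929978, 2957642, 2295589, 12270696] : List ℤ),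
   ([146620, 284852, -783429, -118199, 3072557, -635949, -453061, 2107704, -557425, 835688, 433674,
    1130460] : List ℤ),
   ([-9184428, -5184583, -1061459, 5064639, -2151748, -1482391, -1116147, -1980214, -9647274, 63353,
    -1292833, 7023224] : List ℤ),
   ([5471938, -4097156, -2550812, 5184583, -3805393, -241903, 5910671, -1798031, 3617274, -3924415,
    1482391, 3147978, -3516090, -63353, -1660905, 6377932] : List ℤ),
   ([392045, -916520, 454186, -802343, -47837, -1074509, 2233195, -2586487, -2342858, 252457,
    -846869, -47118, 3576464] : List ℤ),
   ([-1446816, 5450693, 7359969, -2233195, 877332, 8871448] : List ℤ),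
   ([2115023, -3128907, -1995508, 3340418, -156983, 494279, 3720793, 1852294, -5640189, -641904,
    703266, -698889, -3890445, -1042892, 505448, 701242, 8891876] : List ℤ),
   ([-2115023, 2244482, -367828, 156983, -1680617, 1682063, 1594723, -1852294, 1356339, -823622,
    698889, -505448, -422117, 3556036] : List ℤ),
   ([-5154507, -2946806, 1947156, 2528575, -521423, -47561, -621757, -3645776, -3940971, 65058,
    859352, 3285895, 2229404] : List ℤ),
   ([-10874648, 5154507, 3439825, -7871246, 1443986, -2528575, -3546956, 1976539, 521423, -1416723,
    -3882013, -4702984, 3645776, -3283086, 11253866, -3285895, -879135, 15712868] : List ℤ),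
   ([-606634, -3732075, 23709, -4268479, 1439558, 2986728] : List ℤ),
   ([1962028, 2342568, -10211418, -3925818, -4271931, -534413, -197499, 7294052, -23709, -911874,
    -4657586, 1086874, -904013, 14955544] : List ℤ),
   ([5969567, -3358585, -657421, 2388873, -3410694, 953318, -420067, 295129, 715465, 199175,
    2356604, 4419593, -2910881, -1520373, -3180706, 775186, 360951, -1885600, 2142576] : List ℤ),
   ([2140661, -3691682, 657421, -1416174, -3987658, 420067, -1846484, -1342293, 468499, -199175,
    -490019, -850272, 1322066, -360951, 5764220] : List ℤ),
   ([5917219, 3603269, -1020387, -2190446, -340561, 2123598, -53174, 3308211, 6240818, 134555,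
    -702105, -1900684, -1314974, 1495412, 4088624] : List ℤ),
   ([-3735926, 2193009, 778266, -3603269, 1488048, -2636422, -1224246, -571565, -706603, 1407637,
    -2123598, -1907359, 621363, -134555, 2068428, -2130294, -1124850, 1314974, -876657,
    3818172] : List ℤ)]

/-- The rows of the operator `X` below `threeOmega` for the control outcome `+`. -/
def threePlus : List (List ℤ) :=
  [([-1658469747] : List ℤ),
   ([-10254848131] : List ℤ),
   ([-10241684377] : List ℤ),
   ([1669340665, -1671633501] : List ℤ),
   ([1694965250, -10254848131] : List ℤ),
   ([-40082503567] : List ℤ),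
   ([1688395760, -1682284560, -40079252385] : List ℤ),
   ([-1688395760, 10256951059, -10258099313] : List ℤ),
   ([1689478786, -10241684377] : List ℤ),
   ([1688395760, -1689478786, 36720076691, -40079252385] : List ℤ),
   ([-40075827067] : List ℤ),
   ([-1687050442, 10244873977, -10245109695] : List ℤ),
   ([1669340665, -1677335476, -1689478786, -1682284560, -1671633501] : List ℤ),
   ([10256951059, -1688395760, 1689478786, -10258099313] : List ℤ),
   ([10244873977, -1687050442, 1687616358, -10245109695] : List ℤ),
   ([-1678531551, 1681417747, 1687050442, 1687050442, 1681417747, -1684623119] : List ℤ),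
   ([1694965250, 1694965250, -1693190081, -1693190081, -10254848131] : List ℤ),
   ([10272729718, -40082503567] : List ℤ),
   ([1688395760, -1682284560, 10272148920, -13625475009, -1686336505, 1684327159,
    -40079252385] : List ℤ),
   ([-1688395760, -1693190081, 1695546048, 1686336505, 10256951059, -10258099313] : List ℤ),
   ([10272729718, 10272729718, -40082503567] : List ℤ),
   ([-34091439319] : List ℤ),
   ([-13637956982, 10260678892, -10249313436, 13625475009, 10260678892, -10249313436,
    -34119539997] : List ℤ),
   ([-10260678892, -10260678892, 40071397437, -40054402889] : List ℤ),
   ([1688395760, -1686336505, -13625475009, 10272148920, -1682284560, 1684327159, 10254508650,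
    -40079252385] : List ℤ),
   ([10260678892, -13637956982, 13625475009, -10249313436, 10260678892, -10254508650, 13622824549,
    -34119539997] : List ℤ),
   ([10259860152, 10259860152, -10248061722, -10248061722, -34137339347] : List ℤ),
   ([-1687091939, 1689214500, 13616859346, -10259860152, 1679844555, -1683536274, -10250676410,
    40072860887, -40061453035] : List ℤ),
   ([-1693190081, -1688395760, 1686336505, 1695546048, 10256951059, -10254063186, -10254508650,
    -10249313436, -10258099313] : List ℤ),
   ([-10260678892, 40071397437, -10260678892, 10254508650, -40054402889] : List ℤ),
   ([-1687091939, 1679844555, -10259860152, 13616859346, 1689214500, -1683536274, 40072860887,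
    -10250676410, 10246284018, -40061453035] : List ℤ),
   ([1687091939, 1687091939, -1689214500, -1689214500, -10253308659, 10255487609, 10250676410,
    10250676410, 10255487609, -10251049167] : List ℤ),
   ([1689478786, 1689478786, -1687000662, -1687000662, -13622591376, -10241684377] : List ℤ),
   ([1688395760, -1689478786, -13625475009, 10254508650, -1686336505, 1687000662, 36720076691,
    -13625475009, 13622591376, -36708257783, -40079252385] : List ℤ),
   ([10256950694, -40075827067] : List ℤ),
   ([-1687050442, -1687000662, 1687036742, 1686366417, 13620355037, 10244873977,
    -10245109695] : List ℤ),
   ([1688395760, -1686336505, 10254508650, -13625475009, -1689478786, 1687000662, -13625475009,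
    36720076691, -36708257783, 13622591376, 10272148920, -40079252385] : List ℤ),
   ([10260678892, 10260678892, -10254508650, -10254508650, -13637956982, 13625475009, 13622824549,
    13622824549, 13625475009, -13622591376, -34119539997] : List ℤ),
   ([10259860152, -13622591376, 13620355037, -10256950694, 13636605409, 10259860152, -10248061722,
    -34137339347] : List ℤ),
   ([-1687091939, 1689214500, -10250676410, 13622591376, 1687000662, -1687036742, 13616859346,
    -36708257783, 36706295831, -13620355037, -10259860152, 40072860887, -40061453035] : List ℤ),
   ([10256950694, 10256950694, -40075827067] : List ℤ),
   ([-13622591376, 10259860152, -10256950694, 13620355037, 13636605409, 10259860152, -10256950694,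
    13636605409, -34137339347] : List ℤ),
   ([-34153305665] : List ℤ),
   ([-10250470014, -10250470014, 40068826825, -40059860749] : List ℤ),
   ([-1687000662, -1687050442, 1686366417, 1687036742, 13620355037, 10244873977, -10245717478,
    -10256950694, -10248061722, -10245109695] : List ℤ),
   ([-1687091939, 1687000662, 13622591376, -10250676410, 1689214500, -1687036742, -36708257783,
    13616859346, -13620355037, 36706295831, 40072860887, -10259860152, 10256950694,
    -40061453035] : List ℤ),
   ([-10250470014, 40068826825, -10250470014, 10242036396, -40059860749] : List ℤ),
   ([1688199845, 1688199845, -1687256838, -1687256838, -13624733606, -10246845393, 10248908039,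
    10250470014, 10250470014, 10248908039, -10246701981] : List ℤ),
   ([1669340665, -1677335476, -1686336505, -1686336505, -1677335476, 1681335658, -1689478786,
    -1689478786, 1687000662, 1687000662, -1682284560, -1682284560, 1679844555, 1679844555,
    -1671633501] : List ℤ),
   ([10256951059, -1693190081, 1686336505, -10254063186, -1688395760, 1689478786, 13625475009,
    -10254508650, 1686336505, -1687000662, -10249313436, -10258099313] : List ℤ),
   ([10244873977, -1687000662, 1686366417, -10245717478, -10256950694, -1687050442, 1687616358,
    -10248061722, 13620355037, 1686366417, -1691094101, -10245109695] : List ℤ),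
   ([-1678531551, 1681417747, 1684327159, 1687000662, 1681335658, -1685681184, 1687050442,
    1687000662, -1687036742, -1686366417, 1687050442, 1684327159, -1683536274, -1686366417,
    1681417747, -1684623119] : List ℤ),
   ([-1693190081, 10256951059, -10254063186, 1686336505, -1688395760, 1686336505, -10254508650,
    13625475009, 1689478786, -1687000662, -10249313436, 1695546048, -10258099313] : List ℤ),
   ([40071397437, -10260678892, -10260678892, 10254508650, 10254508650, -40054402889] : List ℤ),
   ([-1687091939, 1679844555, 40072860887, -36708257783, 1687000662, -1686366417, -10259860152,
    13622591376, -13620355037, 10256950694, 13616859346, -10250676410, 10246284018, -13620355037,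
    1689214500, -1683536274, -40061453035] : List ℤ),
   ([1687091939, -10253308659, 10255487609, -1687000662, 1687091939, -1689214500, 10250676410,
    -13622591376, -1687000662, 1687036742, 10250676410, -1689214500, 10255487609,
    -10251049167] : List ℤ),
   ([-1687000662, 10244873977, -10245717478, 1686366417, -10256950694, -1687050442, 1686366417,
    13620355037, -10248061722, 1687616358, -1691094101, 1687036742, -10245109695] : List ℤ),
   ([-1687091939, 1687000662, -36708257783, 40072860887, 1679844555, -1686366417, 13622591376,
    -10259860152, 10256950694, -13620355037, -10250676410, 13616859346, -13620355037, 10246284018,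
    1689214500, -1687036742, 36706295831, -40061453035] : List ℤ),
   ([40068826825, -10250470014, -10250470014, 10242036396, 10242036396, -40059860749] : List ℤ),
   ([1688199845, -10246845393, 10248908039, -1691094101, 10250470014, 1688199845, -1687256838,
    -13624733606, 10250470014, -1691094101, 1691863980, -1687256838, 10248908039,
    -10246701981] : List ℤ),
   ([-1678531551, 1681335658, 1687000662, 1684327159, 1681417747, -1685681184, 1687000662,
    1687050442, -1686366417, -1687036742, 1684327159, 1687050442, -1686366417, -1683536274,
    1681417747, -1685681184, -1687036742, -1683536274, -1684623119] : List ℤ),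
   ([-10253308659, 1687091939, -1687000662, 10255487609, 1687091939, -1687000662, -13622591376,
    10250676410, -1689214500, 1687036742, 10250676410, 10255487609, -1689214500, 1687036742,
    -10251049167] : List ℤ),
   ([-10246845393, 1688199845, -1691094101, 10248908039, 10250470014, 1688199845, -1691094101,
    10250470014, -13624733606, -1687256838, 1691863980, 10248908039, -1687256838, 1691863980,
    -10246701981] : List ℤ),
   ([1682901824, -1684994817, -1688199845, -1688199845, -1684994817, 1687997317, -1688199845,
    -1688199845, 1687256838, 1687256838, -1688199845, -1688199845, 1687256838, 1687256838,
    -1684994817, 1687997317, 1687256838, 1687256838, 1687997317, -1688970305] : List ℤ)]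

/-- The rows of the operator `X` below `threeOmega` for the control outcome `-`. -/
def threeMinus : List (List ℤ) :=
  [([-179043396639] : List ℤ),
   ([-77747354109] : List ℤ),
   ([-116395295265] : List ℤ),
   ([20294116689, -140395455483] : List ℤ),
   ([-24415585713, -77747354109] : List ℤ),
   ([-46450674083] : List ℤ),
   ([-22076411954, 13863566739, -57002549023] : List ℤ),
   ([22076411954, -31263256307, -67195479169] : List ℤ),
   ([-13863011746, -116395295265] : List ℤ),
   ([-22076411954, 13863011746, -57013145353, -57002549023] : List ℤ),
   ([-75215978379] : List ℤ),
   ([7757543368, -9393049645, -98181865909] : List ℤ),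
   ([20294116689, 7224189328, 13863011746, 13863566739, -140395455483] : List ℤ),
   ([-31263256307, 22076411954, -13863011746, -67195479169] : List ℤ),
   ([-9393049645, 7757543368, 10502771339, -98181865909] : List ℤ),
   ([-4067163404, -1576089973, -7757543368, -7757543368, -1576089973, -109409068743] : List ℤ),
   ([-24415585713, -24415585713, -7612796624, -7612796624, -77747354109] : List ℤ),
   ([-10397960685, -46450674083] : List ℤ),
   ([-22076411954, 13863566739, -10596905457, -10596948438, -5469338717, 1262182572,
    -57002549023] : List ℤ),
   ([22076411954, -7612796624, -24216640941, 5469338717, -31263256307, -67195479169] : List ℤ),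
   ([-10397960685, -10397960685, -46450674083] : List ℤ),
   ([-53507299521] : List ℤ),
   ([-6875502323, -6873771486, 10597872091, 10596948438, -6873771486, 10597872091,
    -53309630645] : List ℤ),
   ([6873771486, 6873771486, -29189743055, -46648342959] : List ℤ),
   ([-22076411954, -5469338717, -10596948438, -10596905457, 13863566739, 1262182572, -10598548672,
    -57002549023] : List ℤ),
   ([-6873771486, -6875502323, 10596948438, 10597872091, -6873771486, 10598548672, -53325264315,
    -53309630645] : List ℤ),
   ([-10883563654, -10883563654, 8359746631, 8359746631, -55550773929] : List ℤ),
   ([-3309859725, -18066619786, 10880377661, 10883563654, 1265417424, 16101692199, 10884091744,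
    -35535990685, -54761405739] : List ℤ),
   ([-7612796624, 22076411954, 5469338717, -24216640941, -31263256307, -18178819732, 10598548672,
    10597872091, -67195479169] : List ℤ),
   ([6873771486, -29189743055, 6873771486, -10598548672, -46648342959] : List ℤ),
   ([-3309859725, 1265417424, 10883563654, 10880377661, -18066619786, 16101692199, -35535990685,
    10884091744, -8356677225, -54761405739] : List ℤ),
   ([3309859725, 3309859725, 18066619786, 18066619786, -20336792130, -24917008677, -10884091744,
    -10884091744, -24917008677, -59082416389] : List ℤ),
   ([-13863011746, -13863011746, -1264578860, -1264578860, -10883977226, -116395295265] : List ℤ),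
   ([-22076411954, 13863011746, -10596948438, -10598548672, -5469338717, 1264578860, -57013145353,
    -10596948438, 10883977226, -35528308763, -57002549023] : List ℤ),
   ([-8358053216, -75215978379] : List ℤ),
   ([7757543368, -1264578860, -16103507202, -7080353369, 8356268580, -9393049645,
    -98181865909] : List ℤ),
   ([-22076411954, -5469338717, -10598548672, -10596948438, 13863011746, 1264578860, -10596948438,
    -57013145353, -35528308763, 10883977226, -10596905457, -57002549023] : List ℤ),
   ([-6873771486, -6873771486, 10598548672, 10598548672, -6875502323, 10596948438, -53325264315,
    -53325264315, 10596948438, -10883977226, -53309630645] : List ℤ),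
   ([-10883563654, -10883977226, 8356268580, 8358053216, -55564357307, -10883563654, 8359746631,
    -55550773929] : List ℤ),
   ([-3309859725, -18066619786, 10884091744, 10883977226, 1264578860, 16103507202, 10880377661,
    -35528308763, -54774052361, -8356268580, 10883563654, -35535990685, -54761405739] : List ℤ),
   ([-8358053216, -8358053216, -75215978379] : List ℤ),
   ([-10883977226, -10883563654, 8358053216, 8356268580, -55564357307, -10883563654, 8358053216,
    -55564357307, -55550773929] : List ℤ),
   ([-61623858429] : List ℤ),
   ([10892381496, 10892381496, -24908442123, -69142893879] : List ℤ),
   ([-1264578860, 7757543368, -7080353369, -16103507202, 8356268580, -9393049645, -4647918276,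
    8358053216, 8359746631, -98181865909] : List ℤ),
   ([-3309859725, 1264578860, 10883977226, 10884091744, -18066619786, 16103507202, -35528308763,
    10880377661, -8356268580, -54774052361, -35535990685, 10883563654, -8358053216,
    -54761405739] : List ℤ),
   ([10892381496, -24908442123, 10892381496, -2718982109, -69142893879] : List ℤ),
   ([-3195458887, -3195458887, 7749253616, 7749253616, -10885400043, -9770891438, -20020598207,
    -10892381496, -10892381496, -20020598207, -83800377769] : List ℤ),
   ([20294116689, 7224189328, -5469338717, -5469338717, 7224189328, 6274278983, 13863011746,
    13863011746, 1264578860, 1264578860, 13863566739, 13863566739, 1265417424, 1265417424,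
    -140395455483] : List ℤ),
   ([-31263256307, -7612796624, 5469338717, -18178819732, 22076411954, -13863011746, 10596948438,
    10598548672, 5469338717, -1264578860, 10597872091, -67195479169] : List ℤ),
   ([-9393049645, -1264578860, -7080353369, -4647918276, 8358053216, 7757543368, 10502771339,
    8359746631, 8356268580, -7080353369, 12128700176, -98181865909] : List ℤ),
   ([-4067163404, -1576089973, 1262182572, 1264578860, 6274278983, -6306712128, -7757543368,
    1264578860, 16103507202, 7080353369, -7757543368, 1262182572, 16101692199, 7080353369,
    -1576089973, -109409068743] : List ℤ),
   ([-7612796624, -31263256307, -18178819732, 5469338717, 22076411954, 5469338717, 10598548672,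
    10596948438, -13863011746, -1264578860, 10597872091, -24216640941, -67195479169] : List ℤ),
   ([-29189743055, 6873771486, 6873771486, -10598548672, -10598548672, -46648342959] : List ℤ),
   ([-3309859725, 1265417424, -35535990685, -35528308763, 1264578860, 7080353369, 10883563654,
    10883977226, -8356268580, -8358053216, 10880377661, 10884091744, -8356677225, -8356268580,
    -18066619786, 16101692199, -54761405739] : List ℤ),
   ([3309859725, -20336792130, -24917008677, -1264578860, 3309859725, 18066619786, -10884091744,
    -10883977226, -1264578860, -16103507202, -10884091744, 18066619786, -24917008677,
    -59082416389] : List ℤ),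
   ([-1264578860, -9393049645, -4647918276, -7080353369, 8358053216, 7757543368, -7080353369,
    8356268580, 8359746631, 10502771339, 12128700176, -16103507202, -98181865909] : List ℤ),
   ([-3309859725, 1264578860, -35528308763, -35535990685, 1265417424, 7080353369, 10883977226,
    10883563654, -8358053216, -8356268580, 10884091744, 10880377661, -8356268580, -8356677225,
    -18066619786, 16103507202, -54774052361, -54761405739] : List ℤ),
   ([-24908442123, 10892381496, 10892381496, -2718982109, -2718982109, -69142893879] : List ℤ),
   ([-3195458887, -9770891438, -20020598207, 12128700176, -10892381496, -3195458887, 7749253616,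
    -10885400043, -10892381496, 12128700176, 4865076223, 7749253616, -20020598207,
    -83800377769] : List ℤ),
   ([-4067163404, 6274278983, 1264578860, 1262182572, -1576089973, -6306712128, 1264578860,
    -7757543368, 7080353369, 16103507202, 1262182572, -7757543368, 7080353369, 16101692199,
    -1576089973, -6306712128, 16103507202, 16101692199, -109409068743] : List ℤ),
   ([-20336792130, 3309859725, -1264578860, -24917008677, 3309859725, -1264578860, -10883977226,
    -10884091744, 18066619786, -16103507202, -10884091744, -24917008677, 18066619786, -16103507202,
    -59082416389] : List ℤ),
   ([-9770891438, -3195458887, 12128700176, -20020598207, -10892381496, -3195458887, 12128700176,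
    -10892381496, -10885400043, 7749253616, 4865076223, -20020598207, 7749253616, 4865076223,
    -83800377769] : List ℤ),
   ([-8564124793, -14633064096, 3195458887, 3195458887, -14633064096, -6472500443, 3195458887,
    3195458887, -7749253616, -7749253616, 3195458887, 3195458887, -7749253616, -7749253616,
    -14633064096, -6472500443, -7749253616, -7749253616, -6472500443, -84691107363] : List ℤ)]

/-- The rows of a lower triangular factor of `10 ^ 10 * threeOmega`, up to rounding. -/
def threeFactorOmega : List (List ℤ) :=
  [([490632799] : List ℤ),
   ([233575391] : List ℤ),
   ([420282694] : List ℤ),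
   ([-262669415, 222812122] : List ℤ),
   ([-24484429, 275167469] : List ℤ),
   ([74989487] : List ℤ),
   ([-21501498, 3868435, 253616687] : List ℤ),
   ([45164604, -38550198, 116684977] : List ℤ),
   ([169046908, 246451874] : List ℤ),
   ([244946934, -30103488, -46279252, 255481336] : List ℤ),
   ([58575278] : List ℤ),
   ([19381431, -206651466, 413668412] : List ℤ),
   ([-278470947, -106705597, -23483111, 76934595, 189456702] : List ℤ),
   ([-15429536, 113673091, 46792134, 113751647] : List ℤ),
   ([-245699576, 50494864, 17371273, 173481783] : List ℤ),
   ([118067402, -26726394, 102719957, 16123279, 100785464, 175059967] : List ℤ),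
   ([66511930, 115471886, -126651101, 14038719, 283359035] : List ℤ),
   ([-244285442, 33956824] : List ℤ),
   ([30686717, -156382281, 12387060, 156776596, -86544274, -60166992, 273583391] : List ℤ),
   ([-64458460, -59622995, 90523414, -17306016, -47722457, 143343884] : List ℤ),
   ([-8809101, 305619421, 86558491] : List ℤ),
   ([1059794] : List ℤ),
   ([-162984807, -18022552, 60697971, -111224486, 96135019, -157787194, 72829893] : List ℤ),
   ([12916877, -56391462, -102976818, 68090642] : List ℤ),
   ([-20664599, 45043653, 9257876, 94644952, 32669903, 13598101, -81305424, 160650767] : List ℤ),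
   ([31044837, -9259252, -40498733, 195339917, 122377110, 229870595, -65610498, 24756250] : List ℤ),
   ([-2115124, 57893920, 105414497, 110402516, 114357560] : List ℤ),
   ([50248027, 50267237, 63724799, -85157903, -52135097, 23196645, 136174713, 26998164,
    283062995] : List ℤ),
   ([-117397727, -49930053, -40106290, 26140983, -60544690, 23135673, 63009604, -120564629,
    40372049] : List ℤ),
   ([183387439, 195789860, 34343424, 35227013, 6991984] : List ℤ),
   ([-10010378, 69456992, 13309463, -78597909, 95273622, -140972741, -93819597, -37324065,
    -117706354, 139867450] : List ℤ),
   ([21027130, -41247509, -30096348, -5674528, 138726899, -45580002, 81262846, -46865177, 15597437,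
    6921812] : List ℤ),
   ([87623713, 44587944, 18677958, -100030866, -93754309, 157464766] : List ℤ),
   ([194120471, 63563779, -5560365, -37350879, 12876359, 85467172, 7412755, 18488942, -4222962,
    -9474728, 7143825] : List ℤ),
   ([120093669, 185450840] : List ℤ),
   ([93907007, -162317773, 47753518, -55332402, -12588757, -78106434, 95915550] : List ℤ),
   ([261122188, -81419707, 36459568, -84221750, -19777739, -71825500, 82967887, 17492527, 37507463,
    -1425699, 128710792, 121353961] : List ℤ),
   ([268413765, 262629111, -45555711, -93386198, -1110763, -9139147, 69273788, -64388516, 22345305,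
    593636, 3831162] : List ℤ),
   ([180289817, 83802828, -280885038, -21546412, -114088616, -60705172, 41230509,
    116527395] : List ℤ),
   ([-217663659, 259697200, -17657144, 35955183, 15461937, 107656250, -5667459, -47887709, 6644722,
    -60623450, 54696146, 42352878, 9321339] : List ℤ),
   ([-1011860, -709147, 1848354] : List ℤ),
   ([374114666, 190475332, 77768565, -119913223, -38117790, 188451123, -738638, -5256902,
    3628298] : List ℤ),
   ([99567716] : List ℤ),
   ([290583172, 18842734, -256410953, 263292875] : List ℤ),
   ([-15571924, 29410349, 13251115, 38936623, 3642280, 7251797, -491387, -1411102, 308716,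
    1137704] : List ℤ),
   ([-166349539, -166733864, -42546117, 82421857, 165959462, -61674202, 168488160, -57498055,
    25838292, 8934340, 121891233, 124547015, 2639918, 5280230] : List ℤ),
   ([-103205486, -28274634, 8526279, 1472809, 15953975] : List ℤ),
   ([-39136087, -47333118, -26743871, 123474892, 203448595, 251173265, -72820978, -139021167,
    10902724, 2938781, 19660534] : List ℤ),
   ([-273691527, -100048925, 9212899, -41838066, -179705581, 5332340, -35361225, -4812127,
    -39896832, 15164927, 16298552, -4707524, -8672078, -11717565, 6016455] : List ℤ),
   ([6277202, 10910497, -65965609, 6692704, 72697987, 29664524, -11954648, 20374282, -4664242,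
    -927610, 778136, 1788781] : List ℤ),
   ([-218529769, -60474477, -45631499, 4611701, -123975317, -20885258, -12654914, -25261035,
    -7967664, -1859252, -283493, 6669226] : List ℤ),
   ([111528174, -52405227, -90322807, 73467964, -107474654, 11069457, 104006694, -47402858,
    93519283, 23487801, -12923562, -27771048, -3981359, -5459125, 1875990, 3941803] : List ℤ),
   ([16784517, -31814228, 21916696, -45481187, 19385934, -93523163, 20387953, 143594663, -39964398,
    711122, 6649439, 7203642, 8376125] : List ℤ),
   ([-192935844, 217202646, 63757485, -15066736, -4239048, 1667568] : List ℤ),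
   ([43108064, -89608680, -73660558, 65517516, -31128891, 40589565, 44815676, 137191288, -198405977,
    7332836, -43035280, -67280506, -531644, -7273572, 1598432, 607447, 3451000] : List ℤ),
   ([-90549907, 73510715, 27811835, -83382338, -51450490, 62443329, 87196246, 1879551, 1764595,
    3218653, 5403556, 2053030, 5093172, 2189145] : List ℤ),
   ([-122643808, -35445068, 35109756, -21142790, -41872553, 32736695, -13245967, -36158333,
    -1766126, -578233, -432508, 1496180, 1494117] : List ℤ),
   ([-221645353, -29955216, 117296788, -77870498, -220276672, 65636020, -137843565, 111515580,
    22979500, 15636703, 39942962, 11830851, -13718797, -16041868, 7547827, 179855, 584038,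
    2130524] : List ℤ),
   ([-103564853, -134177160, 20096505, -18645997, -14452660, 13311356] : List ℤ),
   ([46683531, 63030454, -217550181, -156740647, -52748098, -182936059, -97632801, -157384769,
    -5552938, -8271033, -23118837, 6053660, 4016058, 16445881] : List ℤ),
   ([121670769, -7300592, -15495291, -26816189, 3668571, -19267616, -20182945, 43429930, 8216624,
    -3973882, 37337712, 38077834, -696917, 352454, -370495, 75202, -211789, 200546,
    1618077] : List ℤ),
   ([91647540, -126006473, -20761793, 22394163, -121280477, -6457019, 117984553, 57242898, 208473,
    1180933, 13642783, 11943873, 11926323, 638540, 3413731] : List ℤ),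
   ([140791403, 49633783, -6468260, 59337866, -103626855, 19224708, -19885882, -58652449, 1240037,
    -1233226, -984621, 3211480, 1327137, -1585051, 8655814] : List ℤ),
   ([-76145052, 8658029, 24099102, -62647502, -74753, -106251677, -19840474, -13313711, -17747799,
    -85443640, -86819708, 10910458, -1755420, 20314611, -11378667, -1062230, -4572771, 3392893,
    2392814, 9251921] : List ℤ)]

/-- The rows of a factor of `10 ^ 10 * (threeOmega - threePlus)`, up to rounding. -/
def threeFactorPlus : List (List ℤ) :=
  [([4101879844] : List ℤ),
   ([10129315810] : List ℤ),
   ([10128844038] : List ℤ),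
   ([-4101114982, 125823758] : List ℤ),
   ([-1673891088, 9991140403] : List ℤ),
   ([20020755707] : List ℤ),
   ([-4118723021, -492763581, 19587001494] : List ℤ),
   ([1667882338, -9987785855, 245838744] : List ℤ),
   ([-1660973385, 9987358350] : List ℤ),
   ([-4086852672, 501396944, -19594802779, 103837260] : List ℤ),
   ([20019033117] : List ℤ),
   ([1666394510, -9985478904, 422657784] : List ℤ),
   ([-4103005030, -33142690, -1075503, 55429548, 93858019] : List ℤ),
   ([-10126361590, -3484277, -161192943, 200218266] : List ℤ),
   ([-10124748951, 2450666, 28681985, 181777093] : List ℤ),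
   ([4106225412, -87762244, 1126469, 59715940, 163702636, 115522865] : List ℤ),
   ([-1671792771, -1973539068, -29518952, -5701028, 9796535992] : List ℤ),
   ([-5131954933, 19353265943] : List ℤ),
   ([-4112480700, -682024932, -6126198460, -1929302936, 757520036, -224234719,
    18484434551] : List ℤ),
   ([1665354502, 1972216783, -101883811, -62182914, -9792532856, 221428060] : List ℤ),
   ([-5131072936, -6667980630, 18169648695] : List ℤ),
   ([18450322349] : List ℤ),
   ([13460089817, -8014804110, -26206885, 27423015, -9790948980, -14071894, 48634740] : List ℤ),
   ([5125069156, 6660547266, -18163847729, 89600306] : List ℤ),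
   ([-4118622918, -96300353, 6088057752, -1866235212, 480698145, 784881926, -4655763813,
    17910746448] : List ℤ),
   ([-10128970163, 11952736540, 71537858, -22517067, -9789746943, -8537927, 11140793,
    8204392] : List ℤ),
   ([-10129437286, -11956056103, 11620991, -132020430, 9789932929] : List ℤ),
   ([4118982848, -13679475, -6085418896, 1758933324, -426336983, -858101591, 4636427297,
    -17921320754, 229944776] : List ℤ),
   ([1668866872, 1968403353, 20726306, -242131170, -9791301947, -12035524, 185912148, 11190575,
    26160582] : List ℤ),
   ([5125707668, -19348012123, -2410990, 598239, 2103477] : List ℤ),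
   ([4111775238, 655859918, 6119410784, 1831599457, -933856414, 239237693, -18482413448, -6818822,
    -174720021, 8800018] : List ℤ),
   ([-1665068825, -1968737028, 20289852, 101888982, 9789676089, -179374752, -119867610, -18354582,
    873892, 13235927] : List ℤ),
   ([-1664351931, -1965828213, 33000639, -74676618, 9789216228, 21958105] : List ℤ),
   ([-4092932112, 575216706, 6109929796, 1911751163, -761054086, 232215054, -18497028986, -6249609,
    -699552, -8351760, 37136927] : List ℤ),
   ([-5123248052, 19353537139] : List ℤ),
   ([1669486848, 1964368387, 42316338, -36283077, -9788001852, 24796595, 228980276] : List ℤ),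
   ([-4084917923, 190082131, -6089382757, 1809940631, -440390795, -762050756, 4651040454,
    -17928605337, 4268224, 6052974, -15147048, 5746307] : List ℤ),
   ([-10123496591, -11959267890, -81501695, -54688093, 9789450512, 26264881, -61604209, 2300059,
    -565828, -2894622, 3855958] : List ℤ),
   ([-10121868640, 11961610464, -57095979, 64744124, -9797059514, -29518283, -21687765,
    27265262] : List ℤ),
   ([4086937477, -128014081, 6089643354, -1779581158, 412096387, 828626030, -4639202877,
    17926347137, -222753455, 17458698, -32362834, -5827072, 3951896] : List ℤ),
   ([-5123602404, -6656108652, 18171493523] : List ℤ),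
   ([13464828480, -8022511163, 54971125, 224383973, -9791966094, -31039085, 54047357, -68442599,
    15534845] : List ℤ),
   ([18467454525] : List ℤ),
   ([5121212425, 6654098028, -18169095095, 445648085] : List ℤ),
   ([1664895021, 1966532681, -5118621, -33556118, -9787978039, -23072952, 4658223, 15052450,
    84982192, 34214554] : List ℤ),
   ([4093075246, -614270296, -6110083732, -1887897752, 877665546, -233579127, 18489826776, 7596250,
    214852564, -11653302, -1813938, 1696589, -2976154, 2065857] : List ℤ),
   ([5120060207, -19349153850, -2865873, 57209396, 48172177] : List ℤ),
   ([-1668348985, -1969626221, -40234102, 83158691, 9789832684, -244909159, -149770733, -74269222,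
    -95531502, -61762872, 57740996] : List ℤ),
   ([-4102433355, -12699152, -1625825, -31870729, -87330138, 6056407, 939828, -960963, -5022350,
    6391770, -12251007, -1183464, 203666, 354156, 4457403] : List ℤ),
   ([-10125861047, -1485239, 11028413, 15443268, -1651167, -221991005, 90259588, -16434728,
    29575908, 16859668, -2430001, 2910449] : List ℤ),
   ([-10123621576, 309871, -2927035, 48286771, 1176032, -35950295, 120524064, -112900884, 49929697,
    9026950, -9844181, 6084281] : List ℤ),
   ([4105443244, -145077824, -1587031, 17574776, -133610003, 39902787, 5818741, 6100977, 58152264,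
    -15890136, 102169802, -1406093, 7928482, -4123827, -6731608, 16496207] : List ℤ),
   ([1671961027, -9986847457, 40862904, 156246041, -2928080, 103491795, -213414981, -2934806,
    -41380719, -10149854, 335071, -1151122, 2894174] : List ℤ),
   ([-20015650178, -3003050, -2278338, -80451887, -946286, 1802535] : List ℤ),
   ([4118128825, 470381755, -19582136912, 21273991, 196857997, -99672099, -10935687, -642232,
    111972366, 5418563, -34804539, 17372, -1945483, 1181694, -4676118, -6787623, 2640084] : List ℤ),
   ([-1667641718, 9985254613, -189308720, -56390607, 2521654, -22612797, 135839804, 4004813,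
    39071899, 12470495, 1853089, -242160, -4156170, 2489187] : List ℤ),
   ([1660452218, -9984646330, 19407166, -15426411, 458175, -35130820, -106937110, 93910641,
    -28044953, -3937522, 12775872, -5546492, 5205359] : List ℤ),
   ([4086461220, -472201906, 19590302997, -16103674, -116375255, 129417881, 17433471, 7931942,
    -158864469, -31143094, 110566129, 5414083, 819309, -2544889, -5312247, 10924658, -2462930,
    2486963] : List ℤ),
   ([-20015668701, -4022846, -4081533, -13344292, -33763883, 10726184] : List ℤ),
   ([-1664788016, 9985294162, -258026130, -5214125, -2424725, 141135486, 81384922, -106614681,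
    165946673, 66141256, -48519703, 4312135, -5552929, 10947332] : List ℤ),
   ([4106656417, -40312538, 905444, 18023179, -10511471, 5138640, 1962615, 4500883, 1386227,
    11311437, -27093723, -5282561, 1175664, 623225, 2938193, -1235809, -205302, -422537,
    3745477] : List ℤ),
   ([10124523228, 3954803, 120270204, -125134472, 2648956, 162127443, -62617964, 15706812,
    -33412641, -20767355, 1231185, -1689756, 2141220, -1717519, 1991813] : List ℤ),
   ([10122342267, -3306646, -229236, -136408430, -3270201, 77915527, -92116840, 74668551, -82358688,
    -20632579, 8035950, -3731867, -203957, 515197, 6686433] : List ℤ),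
   ([-4111865326, 68713327, -612337, -48858229, -12684995, -95792216, -5584754, -4717498, -26257118,
    -2824670, -53436837, 11256438, -10501145, 2102020, 2866077, -9844195, 2094744, 371054, -2223703,
    6296414] : List ℤ)]

/-- The rows of a factor of `10 ^ 10 * (threeOmega - threeMinus)`, up to rounding. -/
def threeFactorMinus : List (List ℤ) :=
  [([42316364292] : List ℤ),
   ([27884190836] : List ℤ),
   ([34119343337] : List ℤ),
   ([-4798853694, 37162403024] : List ℤ),
   ([8755862403, 26474227681] : List ℤ),
   ([21552548904] : List ℤ),
   ([5216742362, -3056712297, 23098320242] : List ℤ),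
   ([-7916800294, 14426833074, 20029046248] : List ℤ),
   ([4065176858, 33875014460] : List ℤ),
   ([5219831671, -3058251006, 23098459850, 124171717] : List ℤ),
   ([27416477077] : List ℤ),
   ([-2273410928, 3044269126, 31106219456] : List ℤ),
   ([-4799036904, -2562331577, -5256982693, -304483978, 36698242129] : List ℤ),
   ([11211691993, -12045695869, 20029534281, 3231396] : List ℤ),
   ([2749971834, -2620918313, -2919195233, 30967058556] : List ℤ),
   ([962501445, 547403667, 3214561745, 24971651, 1053919815, 32885956260] : List ℤ),
   ([8756624645, 6327444345, 2703633764, 7768570235, 24355953738] : List ℤ),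
   ([4823619168, 21007148007] : List ℤ),
   ([5217347453, -3057963839, 3004809765, 233665912, 2391586190, -856376607, 22760781475] : List ℤ),
   ([-7917718565, 5493629284, 5004616237, 2653340072, 12852081746, 19541268842] : List ℤ),
   ([4824438479, 3842543628, 20653507350] : List ℤ),
   ([23120834691] : List ℤ),
   ([2464369664, 1781319747, -5600225968, 5746813877, 262295466, -4444591848,
    20969522628] : List ℤ),
   ([-3189262975, -2540039948, 15349343861, 14638184955] : List ℤ),
   ([5216752065, 2145805299, 3693649926, 4892319, -2416161289, -855691099, 3482167982,
    22492511384] : List ℤ),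
   ([2465374254, 1781552916, -5599704571, 5748371978, 262898501, -4443965783, 20969965507,
    3809393] : List ℤ),
   ([3189825388, 2830473853, -2730348023, -2999863460, 22823385468] : List ℤ),
   ([782752751, 4962556248, -4229866613, -444850670, -506592864, -4571437434, -3849490958,
    16205752951, 14345872545] : List ℤ),
   ([2729164546, -9241862555, 5004512619, 732523596, 13465510507, 2770129577, -3034964511,
    -5658002554, 17981601767] : List ℤ),
   ([-3188669843, 14625507896, -5301381953, 14641725018, 2199669] : List ℤ),
   ([782054091, -239034752, -4919934051, 5350565, 4304061906, -4572701286, 15424455811, -6289226592,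
    14349931729, 8902416] : List ℤ),
   ([-1186826113, -858146881, -8871250842, -5226672927, 11652939484, 7828233330, 5980555466,
    -5730582313, 5552059550, 13645192095] : List ℤ),
   ([4064173886, 3605440029, 350721076, 384489384, 3845365958, 33457916468] : List ℤ),
   ([5219242369, -3057406261, 3004161835, 293492051, 2390514575, -855781050, 22758083785, 7158,
    582468, 1382611, 3792952] : List ℤ),
   ([3048807709, 27247263538] : List ℤ),
   ([-2272492921, 645305862, 4949473036, 3008117750, -2436743470, 3207422885,
    30438834495] : List ℤ),
   ([5220019213, 2143477253, 3693311938, 84917883, -2417563478, -855963174, 3482194751, 22493562029,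
    147147, -525852, 82527, 3114057] : List ℤ),
   ([2467362604, 1782847946, -5600667916, 5748528082, 262975435, -4445362336, 20970163764, 3377983,
    -289871, 542669, 1703841] : List ℤ),
   ([3192072255, 2831425058, -2734354486, -3002174208, 22824603708, 475012, 370809,
    5860111] : List ℤ),
   ([779646477, 4965304434, -4231018426, -365380434, -504005370, -4572644971, -3850954439,
    16204695115, 14348204908, 2200294, -2955235, 736875, 3998509] : List ℤ),
   ([3048548968, 2726359637, 27109649602] : List ℤ),
   ([3194581007, 2832745232, -2730692378, -3003077524, 22826222693, 1917747, 525436, 3360309,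
    3192716] : List ℤ),
   ([24814358833] : List ℤ),
   ([-3972311748, -3551718452, 9991891913, 23725870564] : List ℤ),
   ([370442182, -2334367441, 2531688105, 5208792036, -2435706286, 3207432755, 144453868,
    -1140029379, -6134425004, 29791308720] : List ℤ),
   ([780241433, -239354261, -4920253307, -65068186, 4305783867, -4572991432, 15427191801,
    -6287922806, 14349384715, 5960029, 525842, 999, 1634362, 2513322] : List ℤ),
   ([-3973153077, 9585555728, -4535100861, 3824278227, 23411101036] : List ℤ),
   ([936071376, 830435424, -2504147778, -2750410313, 3875890426, 2329616148, 7372302769,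
    -9092313827, 10470072248, 9305939797, 21657751104] : List ℤ),
   ([-4798981489, -2562318292, 3112953708, -584104808, -2332580093, -1955288461, -5568109611,
    -4780187855, 4365328515, 9313844140, -14820281090, 1903748457, -174650845, 14346291221,
    27684227100] : List ℤ),
   ([11211873822, -832462800, 2300196714, -5113352490, -11501896297, 19540626418, 609277, 1570915,
    130510, -508010, -122561, 2439323] : List ℤ),
   ([2750306512, 41725750, 2472768241, 1494956864, -3560250366, -2291535478, -3839737956,
    -209380428, -14849348969, -1217216990, 4558989468, 26277183495] : List ℤ),
   ([962425627, 547286136, -692481702, 413593616, -1642428283, 2000412091, 3598824617, -1382302797,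
    -8549196262, -20280758067, -8388459844, 9345813775, -10505739669, 8761180112, -207736658,
    15538216629] : List ℤ),
   ([2730288540, 10905601122, 2300389183, -7035470719, -10890197866, 2769463912, -3034791613,
    -5654506812, 17982339711, 911131, 1168879, 1982385, 3303962] : List ℤ),
   ([13542851182, -6379198377, -5301202241, 14641256866, 1175581, 2077400] : List ℤ),
   ([782669968, -240284371, 15175237001, -228443147, 1912882261, -3716250019, -7333637653,
    -6289235816, 14348737190, 5716714, -1691932, 1221858, 313313, 945559, 166757, 101698,
    2091483] : List ℤ),
   ([-1187760752, 8075409731, 6154090120, -7879953321, -1200271987, -11712735316, 5980321061,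
    -5730010481, 5552593286, 13645982399, 563859, -271338, 1704056, 1904821] : List ℤ),
   ([369123268, 2727688194, 1254861790, 2603604575, -3559821033, -2291324891, 1790737962,
    -173409327, -11320893827, -6268938475, 3123131605, -1831173456, 27643847412] : List ℤ),
   ([779600311, -238226137, 15175230037, -331678241, 1911974765, -3717005476, -7334904608,
    -6288387593, 14348957533, 3748428, -1940229, -514545, 2073793, 847243, 1968099, -664591,
    1318308, 2710240] : List ℤ),
   ([9084987622, -5015531773, -4535118156, 3824356741, 3254195517, 23183689468] : List ℤ),
   ([937128503, 2772626033, 6230063622, -3179176297, 4623201983, -17828484, -2861592471, 9241123859,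
    -5943884965, -4316013957, 6677499455, -7893557927, 3119511363, 22251271080] : List ℤ),
   ([962543224, -1564949165, -972248282, 396064086, 309160785, 2000747513, -819593410, 3770912176,
    -8551765168, -5853648329, 9604520559, -1008903442, 1198011037, -698576842, 10259865191,
    -911161033, -4869143774, 2276416194, 27075317788] : List ℤ),
   ([7294073158, -3663994137, 6153958287, -5958446009, -1813751956, 5058684081, 9014889152,
    -72642457, -12429620474, 13646619032, 73749, 672701, 36589, 1373588, 2300922] : List ℤ),
   ([2865473863, 600500512, -3748796647, 5907390214, 4625351999, -17267834, -3385564807, 4050789106,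
    -8212146313, -4443537994, 5829683982, 1638861736, -7369366154, -6756884661,
    22526401345] : List ℤ),
   ([2022949989, 4199416598, -1284232206, -349708444, 4358692800, 1824366462, -1520196333,
    -1306811405, 5252270347, 6036848488, -1843409766, 8971034135, -3986138225, -3362648458,
    3382021514, 7929047335, -8883210249, 5909670124, 3404219146, 20549175597] : List ℤ)]

/-- The position of each basis vector of three slots among those of the same charge. -/
def threeRank : List ℕ :=
  [0, 0, 0, 1, 1, 0, 2, 2, 1, 3, 0, 2, 4, 3, 3, 5, 4, 1, 6, 5, 2, 0, 6, 3, 7, 7, 4, 8, 8, 4, 9, 9,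
   5, 10, 1, 6, 11, 10, 7, 12, 2, 8, 0, 3, 9, 13, 4, 10, 14, 11, 11, 15, 12, 5, 16, 13, 12, 17, 5,
   13, 18, 14, 14, 19]

/-! ### The bounds for two and three calls -/

theorem slotSymmetric_ofCode_two {Y : ℕ → ℕ → ℤ}
    (h : ∀ x < 4, ∀ y < 4, ∀ x' < 4, ∀ y' < 4,
      Y (4 * y + x) (4 * y' + x') = Y (4 * x + y) (4 * x' + y')) :
    SlotSymmetric (ofCode 2 Y) := by
  have hd : ∀ u : Fin 2 × Fin 2, 2 * (u.1 : ℕ) + u.2 < 4 := fun u => by omega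
  have hc : ∀ a : Slots 2, code 2 a = 4 * (2 * (a 0).1 + (a 0).2) + (2 * (a 1).1 + (a 1).2) :=
    fun a => by simp [code]
  refine slotSymmetric_of_swap fun i a b => ?_
  obtain rfl : i = 0 := Subsingleton.elim _ _
  simp only [ofCode, of_apply, hc, Fin.castSucc_zero, Fin.succ_zero_eq_one, Equiv.swap_apply_left,
    Equiv.swap_apply_right, h _ (hd (a 0)) _ (hd (a 1)) _ (hd (b 0)) _ (hd (b 1))]

theorem slotSymmetric_ofCode_three {Y : ℕ → ℕ → ℤ}
    (h : ∀ x < 4, ∀ y < 4, ∀ z < 4, ∀ x' < 4, ∀ y' < 4, ∀ z' < 4,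
      Y (16 * y + 4 * x + z) (16 * y' + 4 * x' + z') =
          Y (16 * x + 4 * y + z) (16 * x' + 4 * y' + z') ∧
        Y (16 * x + 4 * z + y) (16 * x' + 4 * z' + y') =
          Y (16 * x + 4 * y + z) (16 * x' + 4 * y' + z')) :
    SlotSymmetric (ofCode 3 Y) := by
  have hd : ∀ u : Fin 2 × Fin 2, 2 * (u.1 : ℕ) + u.2 < 4 := fun u => by omega
  have hc : ∀ a : Slots 3, code 3 a = 16 * (2 * (a 0).1 + (a 0).2) +
      4 * (2 * (a 1).1 + (a 1).2) + (2 * (a 2).1 + (a 2).2) := fun a => by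
    simp [code]
    ring
  refine slotSymmetric_of_swap fun i a b => ?_
  obtain ⟨h1, h2⟩ := h _ (hd (a 0)) _ (hd (a 1)) _ (hd (a 2)) _ (hd (b 0)) _ (hd (b 1)) _ (hd (b 2))
  have e1 : ∀ j : Fin 3, Equiv.swap (0 : Fin 3) 1 j = ![1, 0, 2] j := by decide
  have e2 : ∀ j : Fin 3, Equiv.swap (1 : Fin 3) 2 j = ![0, 2, 1] j := by decide
  fin_cases i
  · change ofCode 3 Y (fun j => a (Equiv.swap (0 : Fin 3) 1 j)) _ = _
    simpa [ofCode, hc, e1] using h1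
  · change ofCode 3 Y (fun j => a (Equiv.swap (1 : Fin 3) 2 j)) _ = _
    simpa [ofCode, hc, e2] using h2

/-- Weak duality for operators with integer entries. -/
theorem RestrictedSimulable.mul_le_of_ofCode {n : ℕ} {p : ℝ} (h : RestrictedSimulable (n + 2) p)
    {Y X₁ X₂ : ℕ → ℕ → ℤ} {Φ : ℤ}
    (hY : ∀ m < n + 2, LastScalar (4 ^ m) (reduceLast^[n + 2 - (m + 1)] Y))
    (hpos : (ofCode (n + 2) Y).PosSemidef)
    (hdom₁ : (ofCode (n + 2) fun a b => Y a b - X₁ a b).PosSemidef)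
    (hdom₂ : (ofCode (n + 2) fun a b => Y a b - X₂ a b).PosSemidef)
    (hsymm₁ : SlotSymmetric (ofCode (n + 2) X₁)) (hsymm₂ : SlotSymmetric (ofCode (n + 2) X₂))
    (hscal₁ : LastScalar (4 ^ (n + 1)) X₁) (hscal₂ : LastScalar (4 ^ (n + 1)) X₂)
    (hΦ : pairing (switchTarget n 1) (ofCode (n + 2) X₁) +
      pairing (switchTarget n (-1)) (ofCode (n + 2) X₂) = (Φ : ℂ) / 2) :
    p * Φ ≤ 2 * (reduceLast^[n + 2] Y 0 0 : ℤ) := by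
  have hsub : ∀ X : ℕ → ℕ → ℤ, ofCode (n + 2) Y - ofCode (n + 2) X =
      ofCode (n + 2) fun a b => Y a b - X a b := fun X => by
    ext a b
    simp [ofCode]
  have hne : (-1 : ℝ) ≠ 1 := by norm_num
  have hs : ∀ (P : Matrix (Slots (n + 2)) (Slots (n + 2)) ℂ → Prop), P (ofCode (n + 2) X₁) →
      P (ofCode (n + 2) X₂) → ∀ s : ℝ, s ^ 2 = 1 →
        P (if s = 1 then ofCode (n + 2) X₁ else ofCode (n + 2) X₂) := by
    intro P h1 h2 s _
    split_ifs
    exacts [h1, h2]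
  have hle := h.mul_le (X := fun s => if s = 1 then ofCode (n + 2) X₁ else ofCode (n + 2) X₂)
    (Φ := Φ / 2) (lam := (reduceLast^[n + 2] Y 0 0 : ℤ)) (dualComb_reductions hY)
    (fun a b => by simp [reductions, code]) (by rwa [reductions_self])
    (by
      rw [reductions_self]
      exact hs (fun X => (ofCode (n + 2) Y - X).PosSemidef) (by rwa [hsub]) (by rwa [hsub]))
    (hs _ hsymm₁ hsymm₂)
    (hs _ (slotScalar_ofCode hscal₁ hsymm₁) (slotScalar_ofCode hscal₂ hsymm₂))
    (by rw [if_pos rfl, if_neg hne, hΦ]; push_cast; rfl)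
  linarith

theorem hasFactor_twoOmega : HasFactor 2 (entry 2 twoRank twoOmega) twoRank twoFactorOmega
    (10 ^ 11) := by
  decide +kernel

theorem hasFactor_twoPlus : HasFactor 2
    (fun a b => entry 2 twoRank twoOmega a b - entry 2 twoRank twoPlus a b) twoRank twoFactorPlus
    (10 ^ 11) := by
  decide +kernel

theorem hasFactor_twoMinus : HasFactor 2
    (fun a b => entry 2 twoRank twoOmega a b - entry 2 twoRank twoMinus a b) twoRank
    twoFactorMinus (10 ^ 11) := by
  decide +kernel

theorem hasFactor_threeOmega : HasFactor 3 (entry 3 threeRank threeOmega) threeRank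
    threeFactorOmega (10 ^ 10) := by
  decide +kernel

theorem hasFactor_threePlus : HasFactor 3
    (fun a b => entry 3 threeRank threeOmega a b - entry 3 threeRank threePlus a b) threeRank
    threeFactorPlus (10 ^ 10) := by
  decide +kernel

theorem hasFactor_threeMinus : HasFactor 3
    (fun a b => entry 3 threeRank threeOmega a b - entry 3 threeRank threeMinus a b) threeRank
    threeFactorMinus (10 ^ 10) := by
  decide +kernel

theorem posSemidef_ofCode_sub_entry {k : ℕ} {R : List ℕ} {D D' L : List (List ℤ)} {s : ℤ}
    (h : HasFactor k (fun a b => entry k R D a b - entry k R D' a b) R L s) (hs : 0 < s) :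
    (ofCode k fun a b => entry k R D a b - entry k R D' a b).PosSemidef :=
  h.posSemidef hs (fun a b => by rw [entry_comm k R D, entry_comm k R D'])
    fun a b hab => by rw [entry_of_ne hab, entry_of_ne hab, sub_zero]

/-- In units of `1 / 10 ^ 7`, the dual comb has the value `4000604`, and `19999998` is twice the
value of the target forms. -/
theorem RestrictedSimulable.two_lt {p : ℝ} (h : RestrictedSimulable 2 p) : p < 4001 / 10000 := by
  have hle := RestrictedSimulable.mul_le_of_ofCode (n := 0) h (Φ := 19999998)
    (Y := entry 2 twoRank twoOmega) (X₁ := entry 2 twoRank twoPlus)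
    (X₂ := entry 2 twoRank twoMinus) (by decide +kernel)
    (hasFactor_twoOmega.posSemidef (by norm_num) (entry_comm _ _ _) fun _ _ => entry_of_ne)
    (posSemidef_ofCode_sub_entry hasFactor_twoPlus (by norm_num))
    (posSemidef_ofCode_sub_entry hasFactor_twoMinus (by norm_num))
    (slotSymmetric_ofCode_two (by decide +kernel)) (slotSymmetric_ofCode_two (by decide +kernel))
    (by decide +kernel) (by decide +kernel) (by
      have h1 := pairing_switchTarget_two 1 (entry 2 twoRank twoPlus)
      have h2 := pairing_switchTarget_two (-1) (entry 2 twoRank twoMinus)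
      have h3 : targetSumTwo 1 (entry 2 twoRank twoPlus) +
        targetSumTwo (-1) (entry 2 twoRank twoMinus) = 19999998 := by decide +kernel
      push_cast at h1 h2
      rw [h1, h2, ← h3]
      push_cast
      ring)
  have hlam : reduceLast^[0 + 2] (entry 2 twoRank twoOmega) 0 0 = 4000604 := by decide +kernel
  rw [hlam] at hle
  push_cast at hle
  linarith

/- The decidability of the symmetry in six bounded variables needs a large instance search. -/
set_option synthInstance.maxHeartbeats 200000 in
set_option synthInstance.maxSize 1024 in
/-- In units of `1 / 10 ^ 8`, the dual comb has the value `65331216`, and `200000002` is twice the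
value of the target forms. -/
theorem RestrictedSimulable.three_lt {p : ℝ} (h : RestrictedSimulable 3 p) :
    p < 6534 / 10000 := by
  have hle := RestrictedSimulable.mul_le_of_ofCode (n := 1) h (Φ := 200000002)
    (Y := entry 3 threeRank threeOmega) (X₁ := entry 3 threeRank threePlus)
    (X₂ := entry 3 threeRank threeMinus) (by decide +kernel)
    (hasFactor_threeOmega.posSemidef (by norm_num) (entry_comm _ _ _) fun _ _ => entry_of_ne)
    (posSemidef_ofCode_sub_entry hasFactor_threePlus (by norm_num))
    (posSemidef_ofCode_sub_entry hasFactor_threeMinus (by norm_num))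
    (slotSymmetric_ofCode_three (by decide +kernel))
    (slotSymmetric_ofCode_three (by decide +kernel))
    (by decide +kernel) (by decide +kernel) (by
      have h1 := pairing_switchTarget_three 1 (entry 3 threeRank threePlus)
      have h2 := pairing_switchTarget_three (-1) (entry 3 threeRank threeMinus)
      have h3 : targetSumThree 1 (entry 3 threeRank threePlus) +
        targetSumThree (-1) (entry 3 threeRank threeMinus) = 200000002 := by decide +kernel
      push_cast at h1 h2
      rw [h1, h2, ← h3]
      push_cast
      ring)
  have hlam : reduceLast^[1 + 2] (entry 3 threeRank threeOmega) 0 0 = 65331216 := by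
    decide +kernel
  rw [hlam] at hle
  push_cast at hle
  linarith

theorem IsComb.isProbComb {k : ℕ} {C : CombOp k} (hC : IsComb C) : IsProbComb C :=
  ⟨C, hC, hC.posSemidef, by rw [sub_self]; exact PosSemidef.zero⟩

theorem DeterministicallySimulable.restrictedSimulable {k : ℕ}
    (h : DeterministicallySimulable k) : RestrictedSimulable k 1 := by
  obtain ⟨C, hC, hrep⟩ := h
  exact ⟨C, hC.isProbComb, hrep⟩

end SwitchSim

theorem mainTheorem2 :
    (∀ p : ℝ, SwitchSim.RestrictedSimulable 2 p → p < 4001 / 10000) ∧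
    (∀ p : ℝ, SwitchSim.RestrictedSimulable 3 p → p < 6534 / 10000) ∧
    ¬ SwitchSim.DeterministicallySimulable 2 ∧
    ¬ SwitchSim.DeterministicallySimulable 3 := by
  refine ⟨fun p h => h.two_lt, fun p h => h.three_lt, fun h => ?_, fun h => ?_⟩
  · have := h.restrictedSimulable.two_lt
    norm_num at this
  · have := h.restrictedSimulable.three_lt
    norm_num at this
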